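/- For $2\times 2$ matrices $A,B$ let $G(A,B)$ be the two-qubit gate acting as $A$ on the even-parity subspace with basis $|00\rangle,|11\rangle$ and as $B$ on the odd-parity subspace with basis $|01\rangle,|10\rangle$. A gate is a *matchgate* if it equals $G(A,B)$ with $A,B$ unitary and $\det A=\det B$. Let $X,Y,Z$ be the Pauli matrices and $H$ the Hadamard matrix. The *entangling power* $e_p(U)$ of a two-qubit unitary $U$ is $\tfrac92$ times the average, over independent uniformly (Haar) distributed one-qubit pure states $\psi_1,\psi_2$, of the linear entropy $1-\operatorname{tr}\rho^2$, where $\rho$ is the reduced state of the first qubit in $U(|\psi_1\rangle\otimes|\psi_2\rangle)$ (so that $e_p(\mathrm{CNOT})=1$). Given an isometry $v:\mathbb C^2\to(\mathbb C^2)^{\otimes k}$, encode $n$ logical qubits in a line of $nk$ physical qubits by $v^{\otimes n}$ (consecutive blocks). A set $S$ of two-qubit gates is *universal under $v$* if for every $n$, every unitary $U$ on $n$ logical qubits and every $\varepsilon>0$ there are a circuit $C$ of gates from $S$ on nearest-neighbour physical qubits and a phase $z$, $|z|=1$, with $\|C\,v^{\otimes n}-z\,v^{\otimes n}U\|<\varepsilon$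 in operator norm. $S$ is *universal* if it is universal under $v$ for some $k$ and some isometry $v$. The *pair encoding* is $k=2$, $|0\rangle\mapsto|00\rangle$, $|1\rangle\mapsto|11\rangle$. Let $0\le\tau\le\pi/2$, let $g_\tau=G(I,e^{i\tau}X)$ (which is SWAP at $\tau=0$ and iSWAP at $\tau=\pi/2$), and let $M_\tau$ be the set of all matchgates together with $g_\tau$. Put $D_\tau=G(H,H)\,G(X,X)\,g_\tau\,G(H,H)$. Then: 1. $D_\tau=\operatorname{diag}(1,e^{i\tau},e^{i\tau},-1)$ in the basis $|00\rangle,|01\rangle,|10\rangle,|11\rangle$, and, applied to physical qubits 2 and 3 of two logical qubits in the pair encoding, it preserves the encoding and acts as the gate $D_\tau$ on the two logical qubits. 2. $D_\tau=(U_1\otimes U_2)\,e^{i(aX\otimes X+bY\otimes Y+cZ\otimes Z)}\,(V_1\otimes V_2)$ for some one-qubit unitaries $U_1,U_2,V_1,V_2$, with $(a,b,c)=(0,0,\tfrac{\pi}{4}-\tfrac{\tau}{2})$. 3. $e_p(D_\tau)=\cos^2\tau$. 4. $M_\tau$ is universal if and only if $\tau\ne\pi/2$; likewise, $M_\tau$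 is universal under the pair encoding if and only if $\tau\neq\pi/2$. 5. If $\tau\ne\pi/2$, there is a polynomial $p$ such that for all $n,s$ every circuit of $s$ gates on $n$ qubits, each an arbitrary one-qubit unitary or a controlled-$Z$ on an arbitrary pair of qubits, is implemented on the pair encoding, up to a global phase, by a circuit of at most $p(n+s)$ nearest-neighbour gates from $M_\tau$. 6. $\tau\ne\pi/2$ if and only if $g_\tau$ is not a matchgate. -/

import Mathlib

open scoped Kronecker Matrix.Norms.L2Operator

namespace Matchgate

/-- Operators on the state space of one qubit, in the basis `|0⟩, |1⟩`. -/
abbrev OneQubit := Matrix (Fin 2) (Fin 2) ℂ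

/-- Operators on the state space of two qubits; the index `(a, b)` is the basis vector `|ab⟩`. -/
abbrev TwoQubit := Matrix (Fin 2 × Fin 2) (Fin 2 × Fin 2) ℂ

/-- Operators on the state space of `n` qubits; the index `x` is the basis vector
`|x 0, x 1, …, x (n - 1)⟩`. -/
abbrev Operator (n : ℕ) := Matrix (Fin n → Fin 2) (Fin n → Fin 2) ℂ

noncomputable section

/-! ## Gates -/

def pauliX : OneQubit := !![0, 1; 1, 0]

def pauliY : OneQubit := !![0, -Complex.I; Complex.I, 0]

def pauliZ : OneQubit := !![1, 0; 0, -1]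

def hadamard : OneQubit := ((Real.sqrt 2 : ℝ) : ℂ)⁻¹ • !![1, 1; 1, -1]

/-- The controlled-`Z` gate `diag(1, 1, 1, -1)`. -/
def controlledZ : TwoQubit := Matrix.diagonal fun x => if x = (1, 1) then -1 else 1

/-- The parity-preserving gate `G(A, B)`: `A` acts on the even subspace with ordered basis
`|00⟩, |11⟩`, and `B` acts on the odd subspace with ordered basis `|01⟩, |10⟩`. -/
def parityGate (A B : OneQubit) : TwoQubit := Matrix.of fun x y =>
  if x.1 = x.2 then
    if y.1 = y.2 then A x.1 y.1 else 0
  else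
    if y.1 = y.2 then 0 else B x.1 y.1

/-- A matchgate is a gate `G(A, B)` with `A`, `B` unitary and `det A = det B`. -/
def IsMatchgate (g : TwoQubit) : Prop :=
  ∃ A ∈ Matrix.unitaryGroup (Fin 2) ℂ, ∃ B ∈ Matrix.unitaryGroup (Fin 2) ℂ,
    A.det = B.det ∧ g = parityGate A B

/-- `G(I, e^{iτ} X)`, which is SWAP at `τ = 0` and iSWAP at `τ = π / 2`. -/
def swapFamily (τ : ℝ) : TwoQubit := parityGate 1 (Complex.exp (Complex.I * τ) • pauliX)

/-- The circuit `G(H, H) G(X, X) SWAP G(H, H)`, with SWAP replaced by the gate `g`. -/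
def encodingCircuit (g : TwoQubit) : TwoQubit :=
  parityGate hadamard hadamard * parityGate pauliX pauliX * g * parityGate hadamard hadamard

/-- `U = (U₁ ⊗ U₂) exp(i (a X ⊗ X + b Y ⊗ Y + c Z ⊗ Z)) (V₁ ⊗ V₂)` for some single-qubit
unitaries `U₁, U₂, V₁, V₂`. -/
def HasNonlocalParameters (U : TwoQubit) (a b c : ℝ) : Prop :=
  ∃ U₁ ∈ Matrix.unitaryGroup (Fin 2) ℂ, ∃ U₂ ∈ Matrix.unitaryGroup (Fin 2) ℂ,
  ∃ V₁ ∈ Matrix.unitaryGroup (Fin 2) ℂ, ∃ V₂ ∈ Matrix.unitaryGroup (Fin 2) ℂ,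
    U = (U₁ ⊗ₖ U₂) *
      NormedSpace.exp (Complex.I • ((a : ℂ) • (pauliX ⊗ₖ pauliX) + (b : ℂ) • (pauliY ⊗ₖ pauliY)
        + (c : ℂ) • (pauliZ ⊗ₖ pauliZ))) *
      (V₁ ⊗ₖ V₂)

/-! ## Entangling power -/

/-- Reduced density matrix, on the first qubit, of the two-qubit pure state `w`. -/
def reducedState (w : Fin 2 × Fin 2 → ℂ) : OneQubit :=
  Matrix.of fun a a' => ∑ b, w (a, b) * star (w (a', b))

/-- Linear entropy `1 - tr ρ²` of the reduced state `ρ` of the two-qubit pure state `w`. -/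
def linearEntropy (w : Fin 2 × Fin 2 → ℂ) : ℝ :=
  1 - (Matrix.trace (reducedState w * reducedState w)).re

/-- Single-qubit pure states, as unit vectors of `ℂ²`. -/
abbrev QubitState := Metric.sphere (0 : EuclideanSpace ℂ (Fin 2)) 1

/-- The rotation-invariant surface measure on the unit sphere of `ℂ²`. -/
def stateMeasure : MeasureTheory.Measure QubitState :=
  (MeasureTheory.volume : MeasureTheory.Measure (EuclideanSpace ℂ (Fin 2))).toSphere

/-- Entangling power: the average over uniformly and independently distributed pure states
`ψ₁, ψ₂` of the linear entropy of entanglement of `U (ψ₁ ⊗ ψ₂)`. The factor `9 / 2` rescales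
it so that the largest value over all two-qubit gates, attained by CNOT and CZ, is `1`. -/
def entanglingPower (U : TwoQubit) : ℝ :=
  9 / 2 * ⨍ ψ : QubitState × QubitState,
    linearEntropy (U.mulVec fun x => ψ.1.1 x.1 * ψ.2.1 x.2) ∂(stateMeasure.prod stateMeasure)

/-! ## Circuits -/

/-- The single-qubit gate `A` on qubit `i` of `n` qubits. -/
def onQubit {n : ℕ} (i : Fin n) (A : OneQubit) : Operator n := Matrix.of fun x y =>
  if ∀ l, l ≠ i → x l = y l then A (x i) (y i) else 0

/-- The two-qubit gate `g` on the (distinct) qubits `i` and `j`, in this order, of `n` qubits. -/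
def onPair {n : ℕ} (i j : Fin n) (g : TwoQubit) : Operator n := Matrix.of fun x y =>
  if ∀ l, l ≠ i → l ≠ j → x l = y l then g (x i, x j) (y i, y j) else 0

/-- The operators implemented by circuits of exactly `s` gates, each from `gates`. -/
def IsCircuit {n : ℕ} (gates : Set (Operator n)) (s : ℕ) (C : Operator n) : Prop :=
  ∃ L : List (Operator n), L.length = s ∧ (∀ A ∈ L, A ∈ gates) ∧ C = L.prod

/-- Two-qubit gates from `S` acting on nearest neighbours of a line of `n` qubits. -/
def neighbourGates (S : Set TwoQubit) (n : ℕ) : Set (Operator n) :=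
  {A | ∃ i j : Fin n, (j : ℕ) = i + 1 ∧ ∃ g ∈ S, A = onPair i j g}

/-- The standard universal gate set: every single-qubit unitary on every qubit, and the perfect
entangler CZ on every pair of distinct qubits. -/
def standardGates (n : ℕ) : Set (Operator n) :=
  {A | (∃ i : Fin n, ∃ B ∈ Matrix.unitaryGroup (Fin 2) ℂ, A = onQubit i B) ∨
    ∃ i j : Fin n, i ≠ j ∧ A = onPair i j controlledZ}

/-! ## Encodings and universality -/

/-- The encoding of `n` logical qubits, one after the other, in blocks of `k` physical qubits
each; every logical qubit is encoded by `v : ℂ² → (ℂ²)^{⊗ k}`. Physical qubit `r` of block `i`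
has position `k * i + r`. -/
def encoding {k : ℕ} (v : Matrix (Fin k → Fin 2) (Fin 2) ℂ) (n : ℕ) :
    Matrix (Fin (n * k) → Fin 2) (Fin n → Fin 2) ℂ := Matrix.of fun x y =>
  ∏ i : Fin n, v (fun r => x (finProdFinEquiv (i, r))) (y i)

/-- The encoding `|0⟩ ↦ |00⟩`, `|1⟩ ↦ |11⟩` of a logical qubit in two physical qubits. -/
def pairEncoding : Matrix (Fin 2 → Fin 2) (Fin 2) ℂ := Matrix.of fun x a =>
  if x 0 = a ∧ x 1 = a then 1 else 0

/-- For every `n`, each unitary `U` on `n` logical qubits is implemented on the encoded qubits, up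
to a global phase and an arbitrarily small error in operator norm, by a circuit of
nearest-neighbour gates from `S`. -/
def IsUniversalUnder (S : Set TwoQubit) {k : ℕ} (v : Matrix (Fin k → Fin 2) (Fin 2) ℂ) : Prop :=
  ∀ n : ℕ, ∀ U ∈ Matrix.unitaryGroup (Fin n → Fin 2) ℂ, ∀ ε : ℝ, 0 < ε →
    ∃ (s : ℕ) (C : Operator (n * k)) (z : ℂ), IsCircuit (neighbourGates S (n * k)) s C ∧
      ‖z‖ = 1 ∧ ‖C * encoding v n - z • (encoding v n * U)‖ < ε

/-- (Encoded) universality: some isometric encoding of a logical qubit in a fixed number of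
physical qubits makes `S` universal. Universality without encoding is the case of the
identity, with one physical qubit for each logical one. -/
def IsUniversal (S : Set TwoQubit) : Prop :=
  ∃ (k : ℕ) (v : Matrix (Fin k → Fin 2) (Fin 2) ℂ), v.conjTranspose * v = 1 ∧ IsUniversalUnder S v

/-- Every circuit of `s` standard gates on `n` qubits is implemented on the encoded qubits,
up to a global phase, by polynomially many (in `n + s`) nearest-neighbour gates from `S`. -/
def HasPolynomialOverheadUnder (S : Set TwoQubit) {k : ℕ}
    (v : Matrix (Fin k → Fin 2) (Fin 2) ℂ) : Prop :=
  ∃ p : Polynomial ℕ, ∀ (n s : ℕ) (U : Operator n), IsCircuit (standardGates n) s U →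
    ∃ (s' : ℕ) (C : Operator (n * k)) (z : ℂ), s' ≤ p.eval (n + s) ∧
      IsCircuit (neighbourGates S (n * k)) s' C ∧
      ‖z‖ = 1 ∧ C * encoding v n = z • (encoding v n * U)

/-- All matchgates, together with the gate `g`. -/
def matchgatesWith (g : TwoQubit) : Set TwoQubit := {h | IsMatchgate h} ∪ {g}

end

end Matchgate

open Matchgate

/-! The proof rests on two opposite mechanisms.

For τ < π/2, the pair encoding makes `G(A, A)` inside a block the logical gate `A`, and `D_τ` across
two adjacent blocks the same diagonal gate on the logical qubits, since both physical bits of a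
block equal the logical bit. Up to local phases, `D_τ` is exp(ic Z⊗Z) with c = π/4 − τ/2 > 0. Powers
give the angle kc, and k is chosen with kc ≤ π/4 ≤ (k+1)c. Two such interactions, of angles c and
kc, separated by a rotation of the first qubit, act on that qubit as `W₀` or `W₁` according to the
second one. The rotation can be tuned so that `W₁W₀⁻¹` in SU(2) is traceless, hence conjugate to iZ,
and then the whole gate is a controlled-Z up to local gates (`exists_controlledZ_eq`). So CZ is
exact at a cost depending only on τ; SWAP is three CNOTs, and swaps carry CZ to distant qubits with
linear overhead. For density, the closure of the implementable operators is a closed submonoid whose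
Hermitian generators form a real vector space by the Lie–Trotter formula (`exp_add_mem`).
Conjugation by CZ and local unitaries puts all Pauli strings in it, hence all Hermitian operators,
and every unitary is exp(iH) (`mem_of_mem_unitaryGroup`).

For τ = π/2, det(e^{iτ}X) = −e^{2iτ} = 1, so all gates are matchgates. Conjugation by a matchgate
circuit on N qubits preserves the span of 1 and the 2N Majorana operators, hence the space of
operators of degree at most d, of dimension at most (2N+1)^d. Were the set universal under `v`, the
compressions of this space to the code space would be invariant under all logical unitaries
(`conj_mem_compressedSpan`). With d = 2k they contain the logical Z of the first block, which is not
scalar, and an invariant space containing such a diagonal matrix has dimension at least 2^n − 1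
(`card_le_finrank_add_one`). For large n this exceeds the polynomial bound.

The entangling power reduces to the mean of |ψ₀|²|ψ₁|² over the sphere of ℂ², which is 1/6 by
invariance under the Hadamard and phase gates. -/

namespace Matchgate
noncomputable section

/-! ## Tensor products of matrices -/

section PureTensor
variable {ι R : Type*} [Fintype ι] [CommSemiring R] {a b c : ι → Type*}

/-- The tensor product of a family of matrices. -/
def pureTensor (f : ∀ i, Matrix (a i) (b i) R) : Matrix (∀ i, a i) (∀ i, b i) R :=
  Matrix.of fun x y => ∏ i, f i (x i) (y i)

theorem pureTensor_apply (f : ∀ i, Matrix (a i) (b i) R) (x y) :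
    pureTensor f x y = ∏ i, f i (x i) (y i) := rfl

theorem pureTensor_mul [DecidableEq ι] [∀ i, Fintype (b i)]
    (f : ∀ i, Matrix (a i) (b i) R) (g : ∀ i, Matrix (b i) (c i) R) :
    pureTensor f * pureTensor g = pureTensor fun i => f i * g i := by
  ext x y
  simp only [Matrix.mul_apply, pureTensor_apply, Finset.prod_univ_sum, Fintype.piFinset_univ,
    Finset.prod_mul_distrib]

theorem pureTensor_one [∀ i, DecidableEq (a i)] [DecidableEq (∀ i, a i)] :
    pureTensor (fun i => (1 : Matrix (a i) (a i) R)) = 1 := by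
  ext x y
  rw [pureTensor_apply, Matrix.one_apply]
  split_ifs with h
  · subst h; simp
  · obtain ⟨i, hi⟩ := Function.ne_iff.mp h
    exact Finset.prod_eq_zero (Finset.mem_univ i) (Matrix.one_apply_ne hi)

theorem pureTensor_conjTranspose [StarRing R] (f : ∀ i, Matrix (a i) (b i) R) :
    (pureTensor f).conjTranspose = pureTensor fun i => (f i).conjTranspose := by
  ext x y
  simp [pureTensor_apply, Matrix.conjTranspose_apply, star_prod]

theorem pureTensor_sum_smul [DecidableEq ι] {κ : Type*} [Fintype κ] (r : ι → κ → R)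
    (g : ∀ i, κ → Matrix (a i) (b i) R) :
    (pureTensor fun i => ∑ j, r i j • g i j) =
      ∑ s : ι → κ, (∏ i, r i (s i)) • pureTensor fun i => g i (s i) := by
  ext x y
  simp only [pureTensor_apply, Matrix.sum_apply, Matrix.smul_apply, smul_eq_mul,
    Finset.prod_univ_sum, Fintype.piFinset_univ, Finset.prod_mul_distrib]

theorem pureTensor_update_apply [DecidableEq ι] (f : ∀ i, Matrix (a i) (b i) R) (i : ι)
    (A : Matrix (a i) (b i) R) (x y) :
    pureTensor (Function.update f i A) x y =
      A (x i) (y i) * ∏ l ∈ Finset.univ.erase i, f l (x l) (y l) := by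
  rw [pureTensor_apply, ← Finset.mul_prod_erase _ _ (Finset.mem_univ i), Function.update_self]
  congr 1
  refine Finset.prod_congr rfl fun l hl => ?_
  rw [Function.update_of_ne (Finset.ne_of_mem_erase hl)]

theorem pureTensor_update_add [DecidableEq ι] (f : ∀ i, Matrix (a i) (b i) R) (i : ι)
    (A B : Matrix (a i) (b i) R) :
    pureTensor (Function.update f i (A + B)) =
      pureTensor (Function.update f i A) + pureTensor (Function.update f i B) := by
  ext x y
  simp only [Matrix.add_apply, pureTensor_update_apply, add_mul]

theorem pureTensor_update_smul [DecidableEq ι] (f : ∀ i, Matrix (a i) (b i) R) (i : ι) (r : R)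
    (A : Matrix (a i) (b i) R) :
    pureTensor (Function.update f i (r • A)) = r • pureTensor (Function.update f i A) := by
  ext x y
  simp only [Matrix.smul_apply, pureTensor_update_apply, smul_eq_mul, mul_assoc]

theorem pureTensor_single [∀ i, DecidableEq (a i)] [∀ i, DecidableEq (b i)]
    [DecidableEq (∀ i, a i)] [DecidableEq (∀ i, b i)] (x : ∀ i, a i) (y : ∀ i, b i) :
    (pureTensor fun i => Matrix.single (x i) (y i) (1 : R)) = Matrix.single x y 1 := by
  ext u w
  rw [pureTensor_apply, Matrix.single_apply]
  split_ifs with h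
  · obtain ⟨rfl, rfl⟩ := h; simp
  · have : ∃ i, ¬ (x i = u i ∧ y i = w i) := by
      by_contra! hc
      exact h ⟨funext fun i => (hc i).1, funext fun i => (hc i).2⟩
    obtain ⟨i, hi⟩ := this
    exact Finset.prod_eq_zero (Finset.mem_univ i) (by rw [Matrix.single_apply, if_neg hi])

end PureTensor

/-! ## Gates on one and two of `n` qubits -/

variable {n : ℕ}

theorem onQubit_eq_pureTensor (i : Fin n) (A : OneQubit) :
    onQubit i A = pureTensor (Function.update (fun _ => (1 : OneQubit)) i A) := by
  ext x y
  rw [pureTensor_update_apply, onQubit, Matrix.of_apply]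
  split_ifs with h
  · rw [Finset.prod_eq_one, mul_one]
    intro l hl
    rw [h l (Finset.ne_of_mem_erase hl), Matrix.one_apply_eq]
  · push Not at h
    obtain ⟨l, hl, hne⟩ := h
    have h0 : (1 : OneQubit) (x l) (y l) = 0 := Matrix.one_apply_ne hne
    rw [Finset.prod_eq_zero (Finset.mem_erase.2 ⟨hl, Finset.mem_univ l⟩) h0, mul_zero]

theorem onQubit_mul (i : Fin n) (A B : OneQubit) : onQubit i A * onQubit i B = onQubit i (A * B) := by
  simp only [onQubit_eq_pureTensor, pureTensor_mul]
  congr 1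
  funext l
  by_cases h : l = i
  · subst h; simp
  · simp [Function.update_of_ne h]

theorem onQubit_one (i : Fin n) : onQubit i 1 = 1 := by
  rw [onQubit_eq_pureTensor, Function.update_eq_self_iff.2 rfl, pureTensor_one]

theorem onQubit_conjTranspose (i : Fin n) (A : OneQubit) :
    (onQubit i A).conjTranspose = onQubit i A.conjTranspose := by
  simp only [onQubit_eq_pureTensor, pureTensor_conjTranspose]
  congr 1
  funext l
  by_cases h : l = i
  · subst h; simp
  · simp [Function.update_of_ne h]

/-- `onQubit i` as a homomorphism of algebras. -/
def onQubitHom (i : Fin n) : OneQubit →ₐ[ℂ] Operator n :=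
  AlgHom.ofLinearMap
    { toFun := onQubit i
      map_add' := fun A B => by simp only [onQubit_eq_pureTensor, pureTensor_update_add]
      map_smul' := fun r A => by simp [onQubit_eq_pureTensor, pureTensor_update_smul] }
    (onQubit_one i) fun A B => (onQubit_mul i A B).symm

theorem onQubitHom_apply (i : Fin n) (A : OneQubit) : onQubitHom i A = onQubit i A := rfl

theorem onQubit_mul_pureTensor (i : Fin n) (A : OneQubit) (f : Fin n → OneQubit) :
    onQubit i A * pureTensor f = pureTensor (Function.update f i (A * f i)) := by
  rw [onQubit_eq_pureTensor, pureTensor_mul]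
  congr 1
  funext l
  by_cases h : l = i
  · subst h; simp
  · simp [Function.update_of_ne h]

theorem pureTensor_mul_onQubit (i : Fin n) (A : OneQubit) (f : Fin n → OneQubit) :
    pureTensor f * onQubit i A = pureTensor (Function.update f i (f i * A)) := by
  rw [onQubit_eq_pureTensor, pureTensor_mul]
  congr 1
  funext l
  by_cases h : l = i
  · subst h; simp
  · simp [Function.update_of_ne h]

/-- Replace the values of the qubits `i` and `j`. -/
def setPair (i j : Fin n) (x : Fin n → Fin 2) (p : Fin 2 × Fin 2) : Fin n → Fin 2 :=
  Function.update (Function.update x i p.1) j p.2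

theorem setPair_left {i j : Fin n} (h : i ≠ j) (x : Fin n → Fin 2) (p) : setPair i j x p i = p.1 := by
  simp [setPair, h]

theorem setPair_right (i j : Fin n) (x : Fin n → Fin 2) (p) : setPair i j x p j = p.2 := by
  simp [setPair]

theorem setPair_of_ne {i j l : Fin n} (hi : l ≠ i) (hj : l ≠ j) (x : Fin n → Fin 2) (p) :
    setPair i j x p l = x l := by
  simp [setPair, hi, hj]

/-- A row of `onPair i j g` is supported on the four strings that agree with `x` away from `i` and
`j`; `setPair` parametrizes them. -/
theorem onPair_mul_apply {m : Type*} {i j : Fin n} (h : i ≠ j) (g : TwoQubit)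
    (M : Matrix (Fin n → Fin 2) m ℂ) (x : Fin n → Fin 2) (y : m) :
    (onPair i j g * M) x y = ∑ p, g (x i, x j) p * M (setPair i j x p) y := by
  rw [Matrix.mul_apply]
  symm
  refine Finset.sum_of_injOn (setPair i j x) ?_ (fun _ _ => Finset.mem_coe.2 (Finset.mem_univ _))
    ?_ ?_
  · intro p _ q _ hpq
    have h1 := congrFun hpq i
    have h2 := congrFun hpq j
    rw [setPair_left h, setPair_left h] at h1
    rw [setPair_right, setPair_right] at h2
    exact Prod.ext h1 h2
  · intro z _ hz
    rw [onPair, Matrix.of_apply, if_neg, zero_mul]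
    intro hc
    refine hz ⟨(z i, z j), Finset.mem_coe.2 (Finset.mem_univ _), funext fun l => ?_⟩
    by_cases hlj : l = j
    · subst hlj; rw [setPair_right]
    · by_cases hli : l = i
      · subst hli; rw [setPair_left h]
      · rw [setPair_of_ne hli hlj, hc l hli hlj]
  · intro p _
    rw [onPair, Matrix.of_apply, if_pos, setPair_left h, setPair_right]
    intro l hi hj
    rw [setPair_of_ne hi hj]

theorem onPair_mul {i j : Fin n} (h : i ≠ j) (g g' : TwoQubit) :
    onPair i j g * onPair i j g' = onPair i j (g * g') := by
  ext x y
  rw [onPair_mul_apply h]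
  simp only [onPair, Matrix.of_apply, setPair_left h, setPair_right]
  by_cases hc : ∀ l, l ≠ i → l ≠ j → x l = y l
  · rw [if_pos hc, Matrix.mul_apply]
    refine Finset.sum_congr rfl fun p _ => ?_
    rw [if_pos]
    intro l hi hj
    rw [setPair_of_ne hi hj, hc l hi hj]
  · rw [if_neg hc]
    refine Finset.sum_eq_zero fun p _ => ?_
    rw [if_neg, mul_zero]
    contrapose! hc
    intro l hi hj
    rw [← hc l hi hj, setPair_of_ne hi hj]

theorem onPair_diagonal {i j : Fin n} (d : Fin 2 × Fin 2 → ℂ) :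
    onPair i j (Matrix.diagonal d) = Matrix.diagonal fun x => d (x i, x j) := by
  ext x y
  rw [onPair, Matrix.of_apply]
  by_cases hxy : x = y
  · subst hxy; simp
  · rw [Matrix.diagonal_apply_ne _ hxy]
    split_ifs with hc
    · rw [Matrix.diagonal_apply_ne]
      intro he
      rw [Prod.mk.injEq] at he
      refine hxy (funext fun l => ?_)
      by_cases hi : l = i
      · subst hi; exact he.1
      · by_cases hj : l = j
        · subst hj; exact he.2
        · exact hc l hi hj
    · rfl

theorem onPair_one (i j : Fin n) : onPair i j (1 : TwoQubit) = 1 := by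
  rw [← Matrix.diagonal_one, onPair_diagonal, Matrix.diagonal_one]

theorem onPair_conjTranspose (i j : Fin n) (g : TwoQubit) :
    (onPair i j g).conjTranspose = onPair i j g.conjTranspose := by
  ext x y
  simp only [Matrix.conjTranspose_apply, onPair, Matrix.of_apply]
  by_cases hc : ∀ l, l ≠ i → l ≠ j → x l = y l
  · rw [if_pos hc, if_pos fun l hi hj => (hc l hi hj).symm]
  · rw [if_neg hc, if_neg fun hc' => hc fun l hi hj => (hc' l hi hj).symm, star_zero]

theorem onPair_add (i j : Fin n) (g g' : TwoQubit) :
    onPair i j (g + g') = onPair i j g + onPair i j g' := by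
  ext x y
  simp only [onPair, Matrix.of_apply, Matrix.add_apply]
  split_ifs <;> simp

theorem onPair_smul (i j : Fin n) (r : ℂ) (g : TwoQubit) :
    onPair i j (r • g) = r • onPair i j g := by
  ext x y
  simp only [onPair, Matrix.of_apply, Matrix.smul_apply]
  split_ifs <;> simp

theorem onPair_kronecker {i j : Fin n} (h : i ≠ j) (A B : OneQubit) :
    onPair i j (A ⊗ₖ B) =
      pureTensor (Function.update (Function.update (fun _ => (1 : OneQubit)) i A) j B) := by
  ext x y
  rw [pureTensor_update_apply,
    ← Finset.mul_prod_erase _ _ (Finset.mem_erase.2 ⟨h, Finset.mem_univ i⟩), Function.update_self,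
    onPair, Matrix.of_apply]
  have hsub : ∀ l ∈ (Finset.univ.erase j).erase i, l ≠ i ∧ l ≠ j := fun l hl => by
    simpa [and_assoc] using hl
  have hprod : ∏ l ∈ (Finset.univ.erase j).erase i,
      Function.update (fun _ => (1 : OneQubit)) i A l (x l) (y l) =
      ∏ l ∈ (Finset.univ.erase j).erase i, (1 : OneQubit) (x l) (y l) :=
    Finset.prod_congr rfl fun l hl => by rw [Function.update_of_ne (hsub l hl).1]
  rw [hprod]
  split_ifs with hc
  · rw [Finset.prod_eq_one, mul_one, Matrix.kroneckerMap_apply, mul_comm]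
    intro l hl
    rw [hc l (hsub l hl).1 (hsub l hl).2, Matrix.one_apply_eq]
  · push Not at hc
    obtain ⟨l, hi, hj, hne⟩ := hc
    have h0 : (1 : OneQubit) (x l) (y l) = 0 := Matrix.one_apply_ne hne
    have hl : l ∈ (Finset.univ.erase j).erase i := by simp [hi, hj]
    rw [Finset.prod_eq_zero hl h0, mul_zero, mul_zero]

theorem onPair_kronecker_eq_mul {i j : Fin n} (h : i ≠ j) (A B : OneQubit) :
    onPair i j (A ⊗ₖ B) = onQubit i A * onQubit j B := by
  rw [onPair_kronecker h, onQubit_eq_pureTensor i, pureTensor_mul_onQubit,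
    Function.update_of_ne h.symm, one_mul]

theorem onPair_kronecker_mul_pureTensor {i j : Fin n} (h : i ≠ j) (A B : OneQubit)
    (f : Fin n → OneQubit) :
    onPair i j (A ⊗ₖ B) * pureTensor f =
      pureTensor (Function.update (Function.update f i (A * f i)) j (B * f j)) := by
  rw [onPair_kronecker h, pureTensor_mul]
  congr 1
  funext l
  by_cases hj : l = j
  · subst hj; simp
  · by_cases hi : l = i
    · subst hi; simp [hj]
    · simp [hi, hj]

theorem pureTensor_mul_onPair_kronecker {i j : Fin n} (h : i ≠ j) (A B : OneQubit)
    (f : Fin n → OneQubit) :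
    pureTensor f * onPair i j (A ⊗ₖ B) =
      pureTensor (Function.update (Function.update f i (f i * A)) j (f j * B)) := by
  rw [onPair_kronecker h, pureTensor_mul]
  congr 1
  funext l
  by_cases hj : l = j
  · subst hj; simp
  · by_cases hi : l = i
    · subst hi; simp [hj]
    · simp [hi, hj]

/-- Every two-qubit operator is a combination of products of matrix units. -/
theorem twoQubit_eq_sum (g : TwoQubit) :
    g = ∑ p, ∑ q, g p q • (Matrix.single p.1 q.1 (1 : ℂ) ⊗ₖ Matrix.single p.2 q.2 1) := by
  conv_lhs => rw [Matrix.matrix_eq_sum_single g]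
  refine Finset.sum_congr rfl fun p _ => Finset.sum_congr rfl fun q _ => ?_
  rw [Matrix.single_kronecker_single, Matrix.smul_single]
  simp

/-- `onPair i j` as a linear map. -/
def onPairHom (i j : Fin n) : TwoQubit →ₗ[ℂ] Operator n where
  toFun := onPair i j
  map_add' := onPair_add i j
  map_smul' := onPair_smul i j

theorem onPairHom_apply (i j : Fin n) (g : TwoQubit) : onPairHom i j g = onPair i j g := rfl

/-- The supports are disjoint; by linearity in `g` it suffices to check products of matrix units. -/
theorem onPair_commute_pureTensor {i j : Fin n} (h : i ≠ j) (g : TwoQubit) {f : Fin n → OneQubit}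
    (hi : f i = 1) (hj : f j = 1) : onPair i j g * pureTensor f = pureTensor f * onPair i j g := by
  rw [twoQubit_eq_sum g, ← onPairHom_apply]
  simp only [map_sum, map_smul, Finset.sum_mul, Finset.mul_sum, smul_mul_assoc, mul_smul_comm,
    onPairHom_apply]
  refine Finset.sum_congr rfl fun p _ => Finset.sum_congr rfl fun q _ => ?_
  rw [onPair_kronecker_mul_pureTensor h, pureTensor_mul_onPair_kronecker h, hi, hj]
  simp

end
end Matchgate

namespace Matchgate
noncomputable section

/-! ## Parity-preserving gates -/

theorem pauliX_mul_self : pauliX * pauliX = 1 := by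
  ext a b; fin_cases a <;> fin_cases b <;> simp [pauliX]

theorem pauliZ_mul_self : pauliZ * pauliZ = 1 := by
  ext a b; fin_cases a <;> fin_cases b <;> simp [pauliZ]

theorem pauliX_isHermitian : pauliX.IsHermitian := by
  ext a b; fin_cases a <;> fin_cases b <;> simp [pauliX]

theorem pauliY_isHermitian : pauliY.IsHermitian := by
  ext a b; fin_cases a <;> fin_cases b <;> simp [pauliY]

theorem pauliZ_isHermitian : pauliZ.IsHermitian := by
  ext a b; fin_cases a <;> fin_cases b <;> simp [pauliZ]

theorem inv_sqrt_two_mul_self : ((√2 : ℝ) : ℂ)⁻¹ * ((√2 : ℝ) : ℂ)⁻¹ = 2⁻¹ := by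
  rw [← mul_inv, ← Complex.ofReal_mul, Real.mul_self_sqrt (by norm_num)]
  norm_num

theorem hadamard_mul_self : hadamard * hadamard = 1 := by
  rw [hadamard, Matrix.smul_mul, Matrix.mul_smul, smul_smul, inv_sqrt_two_mul_self]
  ext a b; fin_cases a <;> fin_cases b <;> norm_num

theorem hadamard_isHermitian : hadamard.IsHermitian := by
  ext a b; fin_cases a <;> fin_cases b <;> simp [hadamard]

theorem hadamard_mul_pauliX_mul_hadamard : hadamard * pauliX * hadamard = pauliZ := by
  rw [hadamard, Matrix.smul_mul, Matrix.smul_mul, Matrix.mul_smul, smul_smul,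
    inv_sqrt_two_mul_self]
  ext a b; fin_cases a <;> fin_cases b <;> norm_num [pauliX, pauliZ]

theorem hadamard_mul_pauliZ_mul_hadamard : hadamard * pauliZ * hadamard = pauliX := by
  rw [← hadamard_mul_pauliX_mul_hadamard, ← mul_assoc, ← mul_assoc, hadamard_mul_self, one_mul,
    mul_assoc, hadamard_mul_self, mul_one]

theorem mem_unitaryGroup_of_isHermitian {ι : Type*} [Fintype ι] [DecidableEq ι]
    {A : Matrix ι ι ℂ} (h : A.IsHermitian) (h2 : A * A = 1) : A ∈ Matrix.unitaryGroup ι ℂ := by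
  rw [Matrix.mem_unitaryGroup_iff, Matrix.star_eq_conjTranspose, h.eq, h2]

theorem pauliX_mem : pauliX ∈ Matrix.unitaryGroup (Fin 2) ℂ :=
  mem_unitaryGroup_of_isHermitian pauliX_isHermitian pauliX_mul_self

theorem hadamard_mem : hadamard ∈ Matrix.unitaryGroup (Fin 2) ℂ :=
  mem_unitaryGroup_of_isHermitian hadamard_isHermitian hadamard_mul_self

theorem parityGate_mul (A B A' B' : OneQubit) :
    parityGate A B * parityGate A' B' = parityGate (A * A') (B * B') := by
  ext ⟨a, b⟩ ⟨c, d⟩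
  fin_cases a <;> fin_cases b <;> fin_cases c <;> fin_cases d <;>
    simp [parityGate, Matrix.mul_apply, Fintype.sum_prod_type]

theorem parityGate_one : parityGate 1 1 = 1 := by
  ext ⟨a, b⟩ ⟨c, d⟩
  fin_cases a <;> fin_cases b <;> fin_cases c <;> fin_cases d <;> simp [parityGate]

theorem parityGate_conjTranspose (A B : OneQubit) :
    (parityGate A B).conjTranspose = parityGate A.conjTranspose B.conjTranspose := by
  ext ⟨a, b⟩ ⟨c, d⟩
  fin_cases a <;> fin_cases b <;> fin_cases c <;> fin_cases d <;> simp [parityGate]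

theorem isMatchgate_parityGate_self {A : OneQubit} (hA : A ∈ Matrix.unitaryGroup (Fin 2) ℂ) :
    IsMatchgate (parityGate A A) := ⟨A, hA, A, hA, rfl, rfl⟩

theorem IsMatchgate.conjTranspose {g : TwoQubit} (hg : IsMatchgate g) :
    IsMatchgate g.conjTranspose := by
  obtain ⟨A, hA, B, hB, h, rfl⟩ := hg
  refine ⟨A.conjTranspose, ?_, B.conjTranspose, ?_, ?_, parityGate_conjTranspose A B⟩
  · exact Unitary.star_mem hA
  · exact Unitary.star_mem hB
  · rw [Matrix.det_conjTranspose, Matrix.det_conjTranspose, h]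

theorem IsMatchgate.mul_conjTranspose {g : TwoQubit} (hg : IsMatchgate g) :
    g * g.conjTranspose = 1 := by
  obtain ⟨A, hA, B, hB, h, rfl⟩ := hg
  rw [parityGate_conjTranspose, parityGate_mul, ← Matrix.star_eq_conjTranspose,
    ← Matrix.star_eq_conjTranspose, Matrix.mem_unitaryGroup_iff.1 hA,
    Matrix.mem_unitaryGroup_iff.1 hB, parityGate_one]

theorem norm_exp_I_mul_ofReal (τ : ℝ) : ‖Complex.exp (Complex.I * τ)‖ = 1 := by
  rw [mul_comm]; exact Complex.norm_exp_ofReal_mul_I τ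

theorem smul_mem_unitaryGroup {ι : Type*} [Fintype ι] [DecidableEq ι] {z : ℂ} (hz : ‖z‖ = 1)
    {A : Matrix ι ι ℂ} (hA : A ∈ Matrix.unitaryGroup ι ℂ) : z • A ∈ Matrix.unitaryGroup ι ℂ := by
  rw [Matrix.mem_unitaryGroup_iff] at hA ⊢
  rw [star_smul, smul_mul_smul_comm, hA, Complex.star_def, Complex.mul_conj, Complex.normSq_eq_norm_sq, hz]
  simp

/-- The entries of the diagonal gate `diag(1, e^{iτ}, e^{iτ}, -1)`. -/
def encodedPhases (τ : ℝ) (x : Fin 2 × Fin 2) : ℂ :=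
  !![1, Complex.exp (Complex.I * τ); Complex.exp (Complex.I * τ), -1] x.1 x.2

/-- Parity gates multiply block by block: the even block is HXH = Z, and in the odd block the two
X's and the two H's cancel, leaving e^{iτ}. -/
theorem encodingCircuit_swapFamily (τ : ℝ) :
    encodingCircuit (swapFamily τ) = Matrix.diagonal (encodedPhases τ) := by
  rw [encodingCircuit, swapFamily, parityGate_mul, parityGate_mul, parityGate_mul, mul_one,
    hadamard_mul_pauliX_mul_hadamard, mul_smul_comm, mul_assoc hadamard, pauliX_mul_self, mul_one,
    smul_mul_assoc, hadamard_mul_self]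
  ext ⟨a, b⟩ ⟨c, d⟩
  fin_cases a <;> fin_cases b <;> fin_cases c <;> fin_cases d <;>
    simp [parityGate, encodedPhases, pauliZ, Matrix.diagonal]

theorem parityGate_injective {A B A' B' : OneQubit} (h : parityGate A B = parityGate A' B') :
    A = A' ∧ B = B' := by
  constructor
  · ext a b
    simpa [parityGate] using congrFun (congrFun h (a, a)) (b, b)
  · ext a b
    have := congrFun (congrFun h (a, a + 1)) (b, b + 1)
    simpa [parityGate] using this

theorem det_exp_smul_pauliX (τ : ℝ) :
    (Complex.exp (Complex.I * τ) • pauliX).det = -Complex.exp (Complex.I * (2 * τ : ℝ)) := by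
  rw [Matrix.det_smul, pauliX, Matrix.det_fin_two_of, Fintype.card_fin, ← Complex.exp_nat_mul]
  simp only [mul_zero, mul_one, zero_sub, mul_neg]
  congr 2
  push_cast
  ring

/-- Here 2τ lies in [0, π], where the cosine is injective. -/
theorem exp_I_mul_eq_neg_one_iff {τ : ℝ} (hτ : τ ∈ Set.Icc 0 (Real.pi / 2)) :
    Complex.exp (Complex.I * (2 * τ : ℝ)) = -1 ↔ τ = Real.pi / 2 := by
  constructor
  · intro h
    have h1 := congrArg Complex.re h
    rw [mul_comm, Complex.exp_ofReal_mul_I_re, Complex.neg_re, Complex.one_re, ← Real.cos_pi] at h1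
    have h2 := Real.injOn_cos ⟨by linarith [hτ.1], by linarith [hτ.2]⟩
      ⟨Real.pi_pos.le, le_rfl⟩ h1
    linarith
  · rintro rfl
    rw [mul_div_cancel₀ _ (two_ne_zero), mul_comm, Complex.exp_pi_mul_I]

/-- A parity gate determines its two blocks, so everything hinges on whether det(e^{iτ}X) = −e^{2iτ}
equals det 1. -/
theorem isMatchgate_swapFamily_iff {τ : ℝ} (hτ : τ ∈ Set.Icc 0 (Real.pi / 2)) :
    IsMatchgate (swapFamily τ) ↔ τ = Real.pi / 2 := by
  rw [← exp_I_mul_eq_neg_one_iff hτ]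
  constructor
  · rintro ⟨A, _, B, _, hdet, h⟩
    obtain ⟨rfl, rfl⟩ := parityGate_injective h
    rw [det_exp_smul_pauliX, Matrix.det_one] at hdet
    rw [hdet, neg_neg]
  · intro h
    refine ⟨1, one_mem _, _, smul_mem_unitaryGroup (norm_exp_I_mul_ofReal τ) pauliX_mem, ?_, rfl⟩
    rw [det_exp_smul_pauliX, h, neg_neg, Matrix.det_one]

theorem pauliZ_eq_diagonal : pauliZ = Matrix.diagonal ![1, -1] := by
  ext a b; fin_cases a <;> fin_cases b <;> simp [pauliZ]

theorem diagonal_mem_unitaryGroup {ι : Type*} [Fintype ι] [DecidableEq ι] {d : ι → ℂ}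
    (h : ∀ i, ‖d i‖ = 1) : Matrix.diagonal d ∈ Matrix.unitaryGroup ι ℂ := by
  rw [Matrix.mem_unitaryGroup_iff, Matrix.star_eq_conjTranspose, Matrix.diagonal_conjTranspose,
    Matrix.diagonal_mul_diagonal, ← Matrix.diagonal_one]
  congr 1
  funext i
  rw [Pi.star_apply, Complex.star_def, Complex.mul_conj, Complex.normSq_eq_norm_sq, h i]
  simp

/-- The one-qubit phases that turn `exp(i c Z ⊗ Z)` into `diag(1, e^{iτ}, e^{iτ}, -1)`, where
`c = π / 4 - τ / 2`. -/
def localPhases (τ : ℝ) : Fin 2 → ℂ :=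
  ![Complex.exp (Complex.I * (-(Real.pi / 4 - τ / 2) / 2 : ℝ)),
    Complex.exp (Complex.I * (τ + 3 * (Real.pi / 4 - τ / 2) / 2 : ℝ))]

theorem norm_localPhases (τ : ℝ) (a : Fin 2) : ‖localPhases τ a‖ = 1 := by
  fin_cases a <;> exact norm_exp_I_mul_ofReal _

/-- The entries of the diagonal gate `exp(iθ Z ⊗ Z)`. -/
def isingPhases (θ : ℝ) (x : Fin 2 × Fin 2) : ℂ :=
  if x.1 = x.2 then Complex.exp (Complex.I * θ) else Complex.exp (Complex.I * (-θ : ℝ))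

/-- With c = π/4 − τ/2, the entries at 00 and 01 force the local phases −c/2 and τ + 3c/2 up to a
common sign. The entry at 11 then has phase 2τ + 4c = π, which is why this c works. -/
theorem encodedPhases_eq (τ : ℝ) (x : Fin 2 × Fin 2) :
    encodedPhases τ x =
      localPhases τ x.1 * localPhases τ x.2 * isingPhases (Real.pi / 4 - τ / 2) x := by
  obtain ⟨a, b⟩ := x
  have hpi : (-1 : ℂ) = Complex.exp (Real.pi * Complex.I) := Complex.exp_pi_mul_I.symm
  fin_cases a <;> fin_cases b <;>
    simp only [encodedPhases, localPhases, isingPhases, Matrix.of_apply, Matrix.cons_val_zero,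
      Matrix.cons_val_one, Fin.zero_eta, Fin.mk_one, if_true, ← Complex.exp_add, zero_ne_one,
      one_ne_zero, if_false, hpi, Matrix.cons_val', Matrix.cons_val_fin_one]
  · rw [eq_comm, ← Complex.exp_zero]
    congr 1
    push_cast; ring
  · congr 1
    push_cast; ring
  · congr 1
    push_cast; ring
  · congr 1
    push_cast; ring

theorem diagonal_encodedPhases (τ : ℝ) :
    Matrix.diagonal (encodedPhases τ) =
      (Matrix.diagonal (localPhases τ) ⊗ₖ Matrix.diagonal (localPhases τ)) *
        Matrix.diagonal (isingPhases (Real.pi / 4 - τ / 2)) := by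
  rw [Matrix.diagonal_kronecker_diagonal, Matrix.diagonal_mul_diagonal]
  congr 1
  funext x
  exact encodedPhases_eq τ x

theorem exp_smul_pauliZ_kronecker (θ : ℝ) :
    NormedSpace.exp (Complex.I • (θ : ℂ) • (pauliZ ⊗ₖ pauliZ)) =
      Matrix.diagonal (isingPhases θ) := by
  rw [pauliZ_eq_diagonal, Matrix.diagonal_kronecker_diagonal, ← Matrix.diagonal_smul,
    ← Matrix.diagonal_smul, Matrix.exp_diagonal]
  congr 1
  funext ⟨a, b⟩
  rw [Pi.coe_exp, ← Complex.exp_eq_exp_ℂ]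
  fin_cases a <;> fin_cases b <;> simp [isingPhases]

theorem hasNonlocalParameters_encodingCircuit (τ : ℝ) :
    HasNonlocalParameters (encodingCircuit (swapFamily τ)) 0 0 (Real.pi / 4 - τ / 2) := by
  have hU := diagonal_mem_unitaryGroup (norm_localPhases τ)
  refine ⟨_, hU, _, hU, 1, one_mem _, 1, one_mem _, ?_⟩
  rw [encodingCircuit_swapFamily, diagonal_encodedPhases, Complex.ofReal_zero, zero_smul, zero_smul,
    zero_add, zero_add, exp_smul_pauliZ_kronecker, Matrix.one_kronecker_one, mul_one]

/-! ## The pair encoding -/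

variable {n k : ℕ}

/-- The `r`-th physical qubit of the `i`-th block. -/
abbrev blockQubit (i : Fin n) (r : Fin k) : Fin (n * k) := finProdFinEquiv (i, r)

theorem encoding_apply (v : Matrix (Fin k → Fin 2) (Fin 2) ℂ) (x y) :
    encoding v n x y = ∏ i, v (fun r => x (blockQubit i r)) (y i) := rfl

theorem encoding_eq_pureTensor (v : Matrix (Fin k → Fin 2) (Fin 2) ℂ) :
    encoding v n = (pureTensor fun _ : Fin n => v).submatrix
      (fun x i r => x (blockQubit i r)) id := rfl

theorem encoding_mul_onQubit (v : Matrix (Fin k → Fin 2) (Fin 2) ℂ) (i : Fin n) (A : OneQubit) :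
    encoding v n * onQubit i A =
      (pureTensor (Function.update (fun _ : Fin n => v) i (v * A))).submatrix
        (fun x i r => x (blockQubit i r)) id := by
  have h : onQubit i A = (onQubit i A).submatrix id id := rfl
  rw [encoding_eq_pureTensor, h, ← Matrix.submatrix_mul _ _ _ _ _ Function.bijective_id,
    onQubit_eq_pureTensor, pureTensor_mul]
  congr 2
  funext l
  by_cases h : l = i
  · subst h; simp
  · simp [h]

theorem pairEncoding_isometry : pairEncoding.conjTranspose * pairEncoding = 1 := by
  ext a b
  rw [Matrix.mul_apply, ← (finTwoArrowEquiv (Fin 2)).symm.sum_comp, Fintype.sum_prod_type]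
  fin_cases a <;> fin_cases b <;> simp [pairEncoding, Matrix.conjTranspose_apply]

theorem sum_parityGate_apply_pair (A B : OneQubit) (a b c : Fin 2) :
    (∑ p : Fin 2 × Fin 2, parityGate A B (a, b) p * if p.1 = c ∧ p.2 = c then 1 else 0) =
      ∑ j, (if a = j ∧ b = j then 1 else 0) * A j c := by
  fin_cases a <;> fin_cases b <;> fin_cases c <;> simp [parityGate, Fintype.sum_prod_type]

/-- The code words |00⟩, |11⟩ are the basis of the even subspace, so only `A` is seen; taking `B =
A` makes every one-qubit unitary available from a matchgate. -/
theorem onPair_parityGate_mul_encoding (i : Fin n) (A B : OneQubit) :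
    (onPair (blockQubit i 0) (blockQubit i 1) (parityGate A B) : Operator (n * 2)) *
        encoding pairEncoding n =
      encoding pairEncoding n * onQubit i A := by
  have hne : blockQubit i (0 : Fin 2) ≠ blockQubit i 1 := by simp [blockQubit]
  ext x y
  rw [encoding_mul_onQubit, onPair_mul_apply hne, Matrix.submatrix_apply, pureTensor_update_apply]
  have key : ∀ p, encoding pairEncoding n (setPair (blockQubit i 0) (blockQubit i 1) x p) y =
      (if p.1 = y i ∧ p.2 = y i then 1 else 0) *
      ∏ l ∈ Finset.univ.erase i, pairEncoding (fun r => x (blockQubit l r)) (y l) := by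
    intro p
    rw [encoding_apply, ← Finset.mul_prod_erase _ _ (Finset.mem_univ i)]
    congr 1
    · simp only [pairEncoding, Matrix.of_apply, setPair_left hne, setPair_right]
    · refine Finset.prod_congr rfl fun l hl => ?_
      congr 1
      funext r
      have hl' := Finset.ne_of_mem_erase hl
      rw [setPair_of_ne] <;> simp [blockQubit, hl']
  simp only [key, ← mul_assoc]
  rw [← Finset.sum_mul]
  congr 1
  rw [Matrix.mul_apply]
  simp only [pairEncoding, Matrix.of_apply, id]
  exact sum_parityGate_apply_pair A B _ _ _

/-- On the support of the encoding every physical bit equals the logical bit of its block, so a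
phase depending on physical bits is the same phase of the logical bits. -/
theorem onPair_diagonal_mul_encoding (i j : Fin n) (d : Fin 2 × Fin 2 → ℂ) :
    (onPair (blockQubit i 1) (blockQubit j 0) (Matrix.diagonal d) : Operator (n * 2)) *
        encoding pairEncoding n =
      encoding pairEncoding n * onPair i j (Matrix.diagonal d) := by
  rw [onPair_diagonal, onPair_diagonal]
  ext x y
  rw [Matrix.diagonal_mul, Matrix.mul_diagonal, mul_comm]
  by_cases h : encoding pairEncoding n x y = 0
  · rw [h, zero_mul, zero_mul]
  · have h1 : ∀ l, pairEncoding (fun r => x (blockQubit l r)) (y l) ≠ 0 := fun l hl =>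
      h (Finset.prod_eq_zero (Finset.mem_univ l) hl)
    have h2 : ∀ l, x (blockQubit l 0) = y l ∧ x (blockQubit l 1) = y l := fun l => by
      have := h1 l
      rw [pairEncoding, Matrix.of_apply] at this
      by_contra hc
      exact this (if_neg hc)
    rw [(h2 i).2, (h2 j).1]

end
end Matchgate

namespace Matchgate
noncomputable section

/-! ## Averages over the unit sphere -/

section Sphere
open MeasureTheory Metric Set
open scoped Pointwise

variable {E : Type*} [NormedAddCommGroup E] [NormedSpace ℝ E]

/-- The action of a linear isometry on the unit sphere. -/
def sphereMap (L : E ≃ₗᵢ[ℝ] E) (x : sphere (0 : E) 1) : sphere (0 : E) 1 :=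
  ⟨L x, by rw [mem_sphere_zero_iff_norm, L.norm_map, norm_eq_of_mem_sphere]⟩

theorem continuous_sphereMap (L : E ≃ₗᵢ[ℝ] E) : Continuous (sphereMap L) :=
  (L.continuous.comp continuous_subtype_val).subtype_mk _

/-- The surface measure of `s` is a constant times the volume of the cone (0,1)·s, and a linear
isometry commutes with forming cones. -/
theorem measurePreserving_sphereMap [FiniteDimensional ℝ E] [MeasurableSpace E] [BorelSpace E]
    {μ : Measure E} (L : E ≃ₗᵢ[ℝ] E) (hL : MeasurePreserving L μ μ) :
    MeasurePreserving (sphereMap L) μ.toSphere μ.toSphere := by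
  refine ⟨(continuous_sphereMap L).measurable, Measure.ext fun s hs => ?_⟩
  have hs' := (continuous_sphereMap L).measurable hs
  rw [Measure.map_apply (continuous_sphereMap L).measurable hs, μ.toSphere_apply' hs,
    μ.toSphere_apply' hs']
  congr 1
  have hL' : MeasurableEmbedding L := L.toHomeomorph.measurableEmbedding
  rw [← hL.measure_preimage_emb hL' (Ioo (0 : ℝ) 1 • (Subtype.val '' s))]
  congr 1
  ext x
  simp only [mem_smul, mem_image, Subtype.exists, mem_preimage, exists_and_right, exists_eq_right,
    sphereMap]
  constructor
  · rintro ⟨r, hr, y, ⟨hy, hys⟩, rfl⟩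
    exact ⟨r, hr, L y, ⟨by rw [mem_sphere_zero_iff_norm, L.norm_map, mem_sphere_zero_iff_norm.1 hy],
      hys⟩, (L.map_smul r y).symm⟩
  · rintro ⟨r, hr, y, ⟨hy, hys⟩, h⟩
    refine ⟨r, hr, L.symm y, ⟨?_, ?_⟩, ?_⟩
    · rw [mem_sphere_zero_iff_norm, L.symm.norm_map, mem_sphere_zero_iff_norm.1 hy]
    · simpa using hys
    · rw [← L.symm.map_smul, h, L.symm_apply_apply]

theorem integral_comp_sphereMap [FiniteDimensional ℝ E] [MeasurableSpace E] [BorelSpace E]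
    {μ : Measure E} (L : E ≃ₗᵢ[ℝ] E) (hL : MeasurePreserving L μ μ) {f : sphere (0 : E) 1 → ℝ}
    (hf : Continuous f) : ∫ x, f (sphereMap L x) ∂μ.toSphere = ∫ x, f x ∂μ.toSphere := by
  have h := measurePreserving_sphereMap L hL
  conv_rhs => rw [← h.map_eq]
  exact (integral_map h.measurable.aemeasurable hf.aestronglyMeasurable).symm

end Sphere

open MeasureTheory

/-- The action of a unitary matrix on Euclidean space. -/
def unitaryIsometry {U : OneQubit} (hU : U ∈ Matrix.unitaryGroup (Fin 2) ℂ) :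
    EuclideanSpace ℂ (Fin 2) ≃ₗᵢ[ℝ] EuclideanSpace ℂ (Fin 2) where
  toLinearEquiv := (Unitary.linearIsometryEquiv
    ⟨Matrix.toEuclideanCLM (𝕜 := ℂ) U, Unitary.map_mem _ hU⟩).toLinearEquiv.restrictScalars ℝ
  norm_map' := (Unitary.linearIsometryEquiv
    ⟨Matrix.toEuclideanCLM (𝕜 := ℂ) U, Unitary.map_mem _ hU⟩).norm_map

theorem unitaryIsometry_apply {U : OneQubit} (hU : U ∈ Matrix.unitaryGroup (Fin 2) ℂ) (x) (a) :
    unitaryIsometry hU x a = U a 0 * x 0 + U a 1 * x 1 := by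
  change (Matrix.toEuclideanCLM (𝕜 := ℂ) U x).ofLp a = _
  rw [Matrix.ofLp_toEuclideanCLM, Matrix.mulVec, dotProduct, Fin.sum_univ_two]

theorem integral_unitary {U : OneQubit} (hU : U ∈ Matrix.unitaryGroup (Fin 2) ℂ)
    {f : QubitState → ℝ} (hf : Continuous f) :
    ∫ x, f (sphereMap (unitaryIsometry hU) x) ∂stateMeasure = ∫ x, f x ∂stateMeasure :=
  integral_comp_sphereMap _ (LinearIsometryEquiv.measurePreserving _) hf

theorem normSq_add_normSq_of_state (ψ : QubitState) :
    Complex.normSq (ψ.1 0) + Complex.normSq (ψ.1 1) = 1 := by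
  have h : ‖ψ.1‖ = 1 := norm_eq_of_mem_sphere ψ
  rw [EuclideanSpace.norm_eq, Real.sqrt_eq_one, Fin.sum_univ_two] at h
  rw [Complex.normSq_eq_norm_sq, Complex.normSq_eq_norm_sq, h]

instance : IsFiniteMeasure stateMeasure := inferInstanceAs (IsFiniteMeasure (Measure.toSphere _))

instance : NeZero stateMeasure := ⟨Measure.toSphere_ne_zero _⟩

theorem continuous_state_apply (a : Fin 2) : Continuous fun ψ : QubitState => ψ.1 a := by
  fun_prop

theorem integrable_of_continuous {f : QubitState → ℝ} (hf : Continuous f) :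
    Integrable f stateMeasure := by
  have : CompactSpace QubitState := isCompact_iff_compactSpace.1 (isCompact_sphere _ _)
  exact hf.integrable_of_hasCompactSupport (HasCompactSupport.of_compactSpace f)

theorem phaseGate_mem : Matrix.diagonal ![1, Complex.I] ∈ Matrix.unitaryGroup (Fin 2) ℂ :=
  diagonal_mem_unitaryGroup fun i => by fin_cases i <;> simp

/-- The phase gate diag(1, i) changes the sign of the integrand. -/
theorem integral_re_sq_mul_conj_sq :
    ∫ ψ : QubitState, (ψ.1 0 ^ 2 * star (ψ.1 1) ^ 2).re ∂stateMeasure = 0 := by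
  have hc : Continuous fun ψ : QubitState => (ψ.1 0 ^ 2 * star (ψ.1 1) ^ 2).re := by
    have h0 := continuous_state_apply 0
    have h1 := continuous_state_apply 1
    fun_prop
  have h := integral_unitary phaseGate_mem hc
  have h2 : ∀ ψ : QubitState, ((sphereMap (unitaryIsometry phaseGate_mem) ψ).1 0 ^ 2 *
      star ((sphereMap (unitaryIsometry phaseGate_mem) ψ).1 1) ^ 2).re =
      -(ψ.1 0 ^ 2 * star (ψ.1 1) ^ 2).re := by
    intro ψ
    simp only [sphereMap, unitaryIsometry_apply]
    simp [mul_pow]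
  simp only [h2, integral_neg] at h
  linarith

/-- The Hadamard gate turns |u|²|w|² into |u² − w²|²/4 = 1/4 − |u|²|w|²/2 − Re(u² w̄²)/2 on unit
vectors. The last term averages to zero, so the integral I over total mass m satisfies I = m/4 −
I/2. -/
theorem integral_normSq_mul_normSq :
    ∫ ψ : QubitState, Complex.normSq (ψ.1 0) * Complex.normSq (ψ.1 1) ∂stateMeasure =
      stateMeasure.real Set.univ / 6 := by
  have h0 := continuous_state_apply 0
  have h1 := continuous_state_apply 1
  have hn0 := Complex.continuous_normSq.comp h0
  have hn1 := Complex.continuous_normSq.comp h1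
  simp only [Function.comp_def] at hn0 hn1
  have hb : Continuous fun ψ : QubitState =>
      Complex.normSq (ψ.1 0) * Complex.normSq (ψ.1 1) := hn0.mul hn1
  have hc : Continuous fun ψ : QubitState => (ψ.1 0 ^ 2 * star (ψ.1 1) ^ 2).re := by fun_prop
  have h := integral_unitary hadamard_mem hb
  have h2 : ∀ ψ : QubitState,
      Complex.normSq ((sphereMap (unitaryIsometry hadamard_mem) ψ).1 0) *
        Complex.normSq ((sphereMap (unitaryIsometry hadamard_mem) ψ).1 1) =
      1 / 4 - Complex.normSq (ψ.1 0) * Complex.normSq (ψ.1 1) / 2 -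
        (ψ.1 0 ^ 2 * star (ψ.1 1) ^ 2).re / 2 := by
    intro ψ
    have hs : Complex.normSq (((√2 : ℝ) : ℂ)⁻¹) = 1 / 2 := by
      rw [map_inv₀, Complex.normSq_ofReal, Real.mul_self_sqrt (by norm_num)]
      norm_num
    have hψ := normSq_add_normSq_of_state ψ
    simp only [sphereMap, unitaryIsometry_apply, hadamard, Matrix.smul_apply, smul_eq_mul,
      mul_assoc, ← mul_add, map_mul, hs]
    simp only [Matrix.of_apply, Matrix.cons_val', Matrix.cons_val_zero, Matrix.cons_val_one,
      Matrix.cons_val_fin_one, one_mul, neg_mul, Complex.star_def]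
    generalize ψ.1 0 = u at *
    generalize ψ.1 1 = w at *
    -- The constant is made homogeneous of degree four by the normalization; the claim then becomes
    -- a polynomial identity.
    have h4 : (1 : ℝ) / 4 = (Complex.normSq u + Complex.normSq w) ^ 2 / 4 := by rw [hψ]; norm_num
    rw [h4]
    simp only [Complex.normSq_apply, pow_two, Complex.mul_re, Complex.mul_im, Complex.add_re,
      Complex.add_im, Complex.neg_re, Complex.neg_im, Complex.conj_re, Complex.conj_im]
    ring
  simp only [h2] at h
  rw [integral_sub, integral_sub, integral_const, integral_div, integral_div,
    integral_re_sq_mul_conj_sq, smul_eq_mul] at h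
  · linarith
  · exact integrable_const _
  · exact (integrable_of_continuous hb).div_const 2
  · exact (integrable_const _).sub ((integrable_of_continuous hb).div_const 2)
  · exact (integrable_of_continuous hc).div_const 2

/-! ## Entangling power -/

/-- With W the 2×2 matrix of amplitudes, ρ = WW*, tr ρ² = (tr ρ)² − 2 det ρ and det ρ = |det W|². -/
theorem linearEntropy_eq (w : Fin 2 × Fin 2 → ℂ) :
    linearEntropy w = 1 - (∑ x, Complex.normSq (w x)) ^ 2 +
      2 * Complex.normSq (w (0, 0) * w (1, 1) - w (0, 1) * w (1, 0)) := by
  simp only [linearEntropy, Matrix.trace_fin_two, Matrix.mul_apply, reducedState, Matrix.of_apply,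
    Fin.sum_univ_two, Fintype.sum_prod_type, Complex.normSq_apply, Complex.mul_re, Complex.mul_im,
    Complex.add_re, Complex.add_im, Complex.star_def, Complex.conj_re, Complex.conj_im,
    Complex.sub_re, Complex.sub_im]
  ring

theorem normSq_encodedPhases (τ : ℝ) (x : Fin 2 × Fin 2) :
    Complex.normSq (encodedPhases τ x) = 1 := by
  obtain ⟨a, b⟩ := x
  fin_cases a <;> fin_cases b <;>
    simp [encodedPhases, Complex.normSq_eq_norm_sq]

theorem normSq_neg_one_sub_exp (τ : ℝ) :
    Complex.normSq (-1 - Complex.exp (Complex.I * τ) * Complex.exp (Complex.I * τ)) =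
      4 * Real.cos τ ^ 2 := by
  have h : -1 - Complex.exp (Complex.I * τ) * Complex.exp (Complex.I * τ) =
      -(Complex.exp (Complex.I * τ) * (2 * Complex.cos τ)) := by
    rw [Complex.two_cos, mul_add, ← Complex.exp_add, ← Complex.exp_add, ← Complex.exp_add]
    ring_nf
    simp only [Complex.exp_zero]
    ring
  rw [h, Complex.normSq_neg, map_mul, Complex.normSq_eq_norm_sq, norm_exp_I_mul_ofReal,
    ← Complex.ofReal_cos, map_mul, Complex.normSq_ofReal]
  norm_num
  ring

/-- Each of the two terms of the amplitude determinant is the product of all four components of the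
states times phases; the phases combine to −1 − e^{2iτ} = −2e^{iτ} cos τ. -/
theorem linearEntropy_encodedPhases (τ : ℝ) (ψ : QubitState × QubitState) :
    linearEntropy ((Matrix.diagonal (encodedPhases τ)).mulVec
      fun x => ψ.1.1 x.1 * ψ.2.1 x.2) =
      8 * Real.cos τ ^ 2 * ((Complex.normSq (ψ.1.1 0) * Complex.normSq (ψ.1.1 1)) *
        (Complex.normSq (ψ.2.1 0) * Complex.normSq (ψ.2.1 1))) := by
  have h1 := normSq_add_normSq_of_state ψ.1
  have h2 := normSq_add_normSq_of_state ψ.2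
  rw [linearEntropy_eq]
  simp only [Matrix.mulVec_diagonal, map_mul, normSq_encodedPhases, one_mul, Fintype.sum_prod_type,
    ← Finset.mul_sum, Fin.sum_univ_two, h2, mul_one, h1]
  have h3 : encodedPhases τ (0, 0) * (ψ.1.1 0 * ψ.2.1 0) * (encodedPhases τ (1, 1) *
      (ψ.1.1 1 * ψ.2.1 1)) - encodedPhases τ (0, 1) * (ψ.1.1 0 * ψ.2.1 1) *
      (encodedPhases τ (1, 0) * (ψ.1.1 1 * ψ.2.1 0)) =
      (-1 - Complex.exp (Complex.I * τ) * Complex.exp (Complex.I * τ)) *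
        ((ψ.1.1 0 * ψ.1.1 1) * (ψ.2.1 0 * ψ.2.1 1)) := by
    simp only [encodedPhases, Matrix.of_apply, Matrix.cons_val', Matrix.cons_val_zero,
      Matrix.cons_val_one, Matrix.cons_val_fin_one]
    ring
  rw [h3]
  simp only [map_mul, normSq_neg_one_sub_exp]
  ring

/-- The two states are independent and each contributes a mean 1/6: (9/2) · 8 · (1/6)² = 1. -/
theorem entanglingPower_encodingCircuit (τ : ℝ) :
    entanglingPower (encodingCircuit (swapFamily τ)) = Real.cos τ ^ 2 := by
  rw [entanglingPower, encodingCircuit_swapFamily]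
  simp only [linearEntropy_encodedPhases]
  have hm : stateMeasure.real Set.univ ≠ 0 := by
    rw [Ne, measureReal_eq_zero_iff, Measure.measure_univ_eq_zero]
    exact NeZero.ne _
  rw [average_eq, integral_const_mul, integral_prod_mul (μ := stateMeasure) (ν := stateMeasure)
      (fun ψ => Complex.normSq (ψ.1 0) * Complex.normSq (ψ.1 1))
      (fun ψ => Complex.normSq (ψ.1 0) * Complex.normSq (ψ.1 1)), integral_normSq_mul_normSq,
    measureReal_def, ← Set.univ_prod_univ, Measure.prod_prod, ENNReal.toReal_mul,
    ← measureReal_def, smul_eq_mul]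
  field_simp
  ring

end
end Matchgate

namespace Matchgate
noncomputable section

/-! ## Exact implementations on the pair encoding -/

variable {n : ℕ}

theorem IsCircuit.one (gates : Set (Operator n)) : IsCircuit gates 0 1 :=
  ⟨[], rfl, by simp, rfl⟩

theorem IsCircuit.of_mem {gates : Set (Operator n)} {A : Operator n} (h : A ∈ gates) :
    IsCircuit gates 1 A :=
  ⟨[A], rfl, by simpa using h, by simp⟩

theorem IsCircuit.mul {gates : Set (Operator n)} {s t : ℕ} {A B : Operator n}
    (hA : IsCircuit gates s A) (hB : IsCircuit gates t B) : IsCircuit gates (s + t) (A * B) := by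
  obtain ⟨L, hL, hLg, rfl⟩ := hA
  obtain ⟨M, hM, hMg, rfl⟩ := hB
  refine ⟨L ++ M, by rw [List.length_append, hL, hM], ?_, List.prod_append.symm⟩
  intro A hA
  rcases List.mem_append.1 hA with h | h
  exacts [hLg A h, hMg A h]

/-- `U` is implemented on the pair encoding, up to a global phase, by at most `s` gates. -/
def Implements (S : Set TwoQubit) (s : ℕ) (U : Operator n) : Prop :=
  ∃ s' ≤ s, ∃ (C : Operator (n * 2)) (z : ℂ), IsCircuit (neighbourGates S (n * 2)) s' C ∧
    ‖z‖ = 1 ∧ C * encoding pairEncoding n = z • (encoding pairEncoding n * U)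

namespace Implements
variable {S : Set TwoQubit} {s t : ℕ} {U V : Operator n}

theorem mono (h : Implements S s U) (hst : s ≤ t) : Implements S t U := by
  obtain ⟨s', hs', h⟩ := h
  exact ⟨s', hs'.trans hst, h⟩

theorem one : Implements S 0 (1 : Operator n) :=
  ⟨0, le_rfl, 1, 1, IsCircuit.one _, norm_one, by rw [one_smul, Matrix.one_mul, Matrix.mul_one]⟩

theorem mul (hU : Implements S s U) (hV : Implements S t V) : Implements S (s + t) (U * V) := by
  obtain ⟨s', hs', C, z, hC, hz, h⟩ := hU
  obtain ⟨t', ht', D, w, hD, hw, h'⟩ := hV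
  refine ⟨s' + t', add_le_add hs' ht', C * D, w * z, hC.mul hD, by rw [norm_mul, hz, hw, one_mul], ?_⟩
  rw [Matrix.mul_assoc, h', Matrix.mul_smul, ← Matrix.mul_assoc, h, Matrix.smul_mul, smul_smul,
    Matrix.mul_assoc]

theorem smul {z : ℂ} (hz : ‖z‖ = 1) (hU : Implements S s U) : Implements S s (z • U) := by
  obtain ⟨s', hs', C, w, hC, hw, h⟩ := hU
  have hz0 : z ≠ 0 := by rintro rfl; simp at hz
  refine ⟨s', hs', C, w * z⁻¹, hC, by rw [norm_mul, norm_inv, hz, hw, inv_one, one_mul], ?_⟩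
  rw [h, Matrix.mul_smul, smul_smul, inv_mul_cancel_right₀ hz0]

theorem list_prod {L : List (Operator n)} (h : ∀ A ∈ L, Implements S s A) :
    Implements S (L.length * s) L.prod := by
  induction L with
  | nil => simpa using one
  | cons A L ih =>
    rw [List.prod_cons, List.length_cons, Nat.succ_mul, add_comm]
    exact (h A (by simp)).mul (ih fun B hB => h B (by simp [hB]))

end Implements

theorem implements_onQubit {S : Set TwoQubit} (hS : ∀ g, IsMatchgate g → g ∈ S) (i : Fin n)
    {A : OneQubit} (hA : A ∈ Matrix.unitaryGroup (Fin 2) ℂ) : Implements S 1 (onQubit i A) := by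
  refine ⟨1, le_rfl, onPair (blockQubit i 0) (blockQubit i 1) (parityGate A A), 1,
    IsCircuit.of_mem ⟨_, _, ?_, _, hS _ (isMatchgate_parityGate_self hA), rfl⟩, norm_one, ?_⟩
  · simp [blockQubit, add_comm]
  · rw [one_smul, onPair_parityGate_mul_encoding]

/-- The last qubit of block `i` and the first of block `i + 1` are neighbours on the line, so the
four factors of the circuit are admissible gates. -/
theorem implements_encodingCircuit {S : Set TwoQubit} (hS : ∀ g, IsMatchgate g → g ∈ S) {τ : ℝ}
    (hτ : swapFamily τ ∈ S) {i j : Fin n} (hij : (j : ℕ) = i + 1) :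
    Implements S 4 (onPair i j (Matrix.diagonal (encodedPhases τ))) := by
  have hval : (blockQubit j (0 : Fin 2) : ℕ) = blockQubit i (1 : Fin 2) + 1 := by
    simp [blockQubit, hij]; ring
  have hne : blockQubit i (1 : Fin 2) ≠ blockQubit j 0 := by
    intro h
    rw [← h] at hval
    omega
  have hmem : ∀ g ∈ S, IsCircuit (neighbourGates S (n * 2)) 1
      (onPair (blockQubit i (1 : Fin 2)) (blockQubit j (0 : Fin 2)) g) := fun g hg =>
    IsCircuit.of_mem ⟨_, _, hval, g, hg, rfl⟩
  have hH := hmem _ (hS _ (isMatchgate_parityGate_self hadamard_mem))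
  have hX := hmem _ (hS _ (isMatchgate_parityGate_self pauliX_mem))
  refine ⟨1 + 1 + 1 + 1, le_rfl, _, 1, ((hH.mul hX).mul (hmem _ hτ)).mul hH, norm_one, ?_⟩
  rw [onPair_mul hne, onPair_mul hne, onPair_mul hne, ← encodingCircuit,
    encodingCircuit_swapFamily, one_smul, onPair_diagonal_mul_encoding]

/-- The two-qubit gate `g` is implemented on neighbouring logical qubits by at most `s` gates. -/
def ImplementsPair (S : Set TwoQubit) (s : ℕ) (g : TwoQubit) : Prop :=
  ∀ (n : ℕ) (i j : Fin n), (j : ℕ) = i + 1 → Implements S s (onPair i j g)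

namespace ImplementsPair
variable {S : Set TwoQubit} {s t : ℕ} {g h : TwoQubit}

theorem one : ImplementsPair S 0 1 := fun n i j _ => by
  rw [onPair_one]
  exact Implements.one

theorem mul (hg : ImplementsPair S s g) (hh : ImplementsPair S t h) :
    ImplementsPair S (s + t) (g * h) := fun n i j hij => by
  have hne : i ≠ j := by rintro rfl; omega
  rw [← onPair_mul hne]
  exact (hg n i j hij).mul (hh n i j hij)

theorem kronecker (hS : ∀ g, IsMatchgate g → g ∈ S) {A B : OneQubit}
    (hA : A ∈ Matrix.unitaryGroup (Fin 2) ℂ) (hB : B ∈ Matrix.unitaryGroup (Fin 2) ℂ) :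
    ImplementsPair S 2 (A ⊗ₖ B) := fun n i j hij => by
  have hne : i ≠ j := by rintro rfl; omega
  rw [onPair_kronecker_eq_mul hne]
  exact (implements_onQubit hS i hA).mul (implements_onQubit hS j hB)

end ImplementsPair

/-! ## The controlled-`Z` gate from an Ising interaction -/

theorem diagonal_isingPhases_mul (θ φ : ℝ) :
    Matrix.diagonal (isingPhases θ) * Matrix.diagonal (isingPhases φ) =
      Matrix.diagonal (isingPhases (θ + φ)) := by
  rw [Matrix.diagonal_mul_diagonal]
  congr 1
  funext x
  rw [isingPhases, isingPhases, isingPhases]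
  split_ifs <;> rw [← Complex.exp_add] <;> congr 1 <;> push_cast <;> ring

theorem diagonal_isingPhases_zero : Matrix.diagonal (isingPhases 0) = 1 := by
  rw [← Matrix.diagonal_one]
  congr 1
  funext x
  simp [isingPhases]

theorem diagonal_isingPhases_eq (τ : ℝ) :
    Matrix.diagonal (isingPhases (Real.pi / 4 - τ / 2)) =
      ((Matrix.diagonal (localPhases τ)).conjTranspose ⊗ₖ
        (Matrix.diagonal (localPhases τ)).conjTranspose) * Matrix.diagonal (encodedPhases τ) := by
  have h := Matrix.mem_unitaryGroup_iff'.1 (diagonal_mem_unitaryGroup (norm_localPhases τ))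
  rw [Matrix.star_eq_conjTranspose] at h
  rw [diagonal_encodedPhases, ← mul_assoc, ← Matrix.mul_kronecker_mul, h,
    Matrix.one_kronecker_one, one_mul]

/-- Each interaction costs six gates: four for the diagonal gate and two for undoing its local
phases. -/
theorem implementsPair_ising {S : Set TwoQubit} (hS : ∀ g, IsMatchgate g → g ∈ S) {τ : ℝ}
    (hτ : swapFamily τ ∈ S) (k : ℕ) :
    ImplementsPair S (k * 6) (Matrix.diagonal (isingPhases (k * (Real.pi / 4 - τ / 2)))) := by
  induction k with
  | zero =>
    rw [Nat.cast_zero, zero_mul, zero_mul, diagonal_isingPhases_zero]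
    exact ImplementsPair.one
  | succ k ih =>
    rw [Nat.cast_succ, add_mul (k : ℝ), one_mul, ← diagonal_isingPhases_mul, add_mul]
    refine ih.mul ?_
    rw [diagonal_isingPhases_eq]
    have hU := Unitary.star_mem (diagonal_mem_unitaryGroup (norm_localPhases τ))
    exact (ImplementsPair.kronecker hS hU hU).mul
      fun n i j hij => implements_encodingCircuit hS hτ hij

/-- The rotation `exp(iθZ)`. -/
def rotationZ (θ : ℝ) : OneQubit :=
  Matrix.diagonal ![Complex.exp (Complex.I * θ), Complex.exp (Complex.I * (-θ : ℝ))]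

theorem rotationZ_mul (θ φ : ℝ) : rotationZ θ * rotationZ φ = rotationZ (θ + φ) := by
  rw [rotationZ, rotationZ, rotationZ, Matrix.diagonal_mul_diagonal]
  congr 1
  funext a
  fin_cases a <;> simp [← Complex.exp_add] <;> congr 1 <;> ring

theorem rotationZ_conjTranspose (θ : ℝ) : (rotationZ θ).conjTranspose = rotationZ (-θ) := by
  rw [rotationZ, rotationZ, Matrix.diagonal_conjTranspose]
  congr 1
  funext a
  fin_cases a <;> simp [← Complex.exp_conj]

theorem rotationZ_mem (θ : ℝ) : rotationZ θ ∈ Matrix.unitaryGroup (Fin 2) ℂ :=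
  diagonal_mem_unitaryGroup fun a => by
    fin_cases a <;> exact norm_exp_I_mul_ofReal _

theorem det_rotationZ (θ : ℝ) : (rotationZ θ).det = 1 := by
  simp [rotationZ, ← Complex.exp_add]

theorem rotationZ_eq (θ : ℝ) : rotationZ θ = !![Real.cos θ + Complex.I * Real.sin θ, 0;
    0, Real.cos θ - Complex.I * Real.sin θ] := by
  have h : ∀ φ : ℝ, Complex.exp (Complex.I * φ) = Real.cos φ + Complex.I * Real.sin φ := by
    intro φ
    rw [mul_comm, Complex.exp_mul_I, Complex.ofReal_cos, Complex.ofReal_sin, mul_comm Complex.I]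
  rw [rotationZ, h, h, Real.cos_neg, Real.sin_neg]
  ext a b
  fin_cases a <;> fin_cases b <;> simp [sub_eq_add_neg]

/-- The real rotation of the plane by the angle `φ`. -/
def planeRotation (φ : ℝ) : OneQubit :=
  !![(Real.cos φ : ℂ), -(Real.sin φ : ℂ); (Real.sin φ : ℂ), (Real.cos φ : ℂ)]

theorem planeRotation_mem (φ : ℝ) : planeRotation φ ∈ Matrix.unitaryGroup (Fin 2) ℂ := by
  have h : (Real.cos φ : ℂ) ^ 2 + (Real.sin φ : ℂ) ^ 2 = 1 := by
    exact_mod_cast Real.cos_sq_add_sin_sq φ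
  rw [Matrix.mem_unitaryGroup_iff, Matrix.star_eq_conjTranspose]
  ext a b
  fin_cases a <;> fin_cases b <;>
    simp only [planeRotation, Matrix.mul_apply, Fin.sum_univ_two, Matrix.conjTranspose_apply,
      Matrix.of_apply, Matrix.cons_val', Matrix.cons_val_zero, Matrix.cons_val_one,
      Matrix.cons_val_fin_one, Fin.zero_eta, Fin.mk_one, map_neg, Complex.star_def,
      Complex.conj_ofReal, Matrix.one_apply, zero_ne_one, one_ne_zero, if_true, if_false]
  · linear_combination h
  · ring
  · ring
  · linear_combination h

/-- This is the composition law of SU(2): conjugation by the plane rotation tilts the axis of the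
second rotation by 2φ, and half the trace of a product is cos a cos b − sin a sin b times the cosine
of the angle between the axes. -/
theorem trace_rotations (φ a b : ℝ) :
    (rotationZ a * (planeRotation φ).conjTranspose * rotationZ b * planeRotation φ).trace =
      2 * (Real.cos a * Real.cos b - Real.sin a * Real.sin b * Real.cos (2 * φ) : ℝ) := by
  have h : (Real.cos φ : ℂ) ^ 2 + (Real.sin φ : ℂ) ^ 2 = 1 := by
    exact_mod_cast Real.cos_sq_add_sin_sq φ
  rw [Real.cos_two_mul]
  have hI := Complex.I_sq
  simp only [rotationZ_eq, planeRotation, Matrix.trace_fin_two, Matrix.mul_apply, Fin.sum_univ_two,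
    Matrix.conjTranspose_apply, Matrix.of_apply, Matrix.cons_val', Matrix.cons_val_zero,
    Matrix.cons_val_one, Matrix.cons_val_fin_one, map_neg, Complex.star_def, Complex.conj_ofReal]
  push_cast at h ⊢
  generalize (Complex.cos φ : ℂ) = p at *
  generalize (Complex.sin φ : ℂ) = q at *
  generalize (Complex.cos a : ℂ) = a₁ at *
  generalize (Complex.sin a : ℂ) = a₂ at *
  generalize (Complex.cos b : ℂ) = b₁ at *
  generalize (Complex.sin b : ℂ) = b₂ at *
  linear_combination (2 * a₁ * b₁ + 2 * a₂ * b₂) * h + 2 * a₂ * b₂ * (p ^ 2 - q ^ 2) * hI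

theorem pauliX_mul_diagonal_mul_pauliX (a b : ℂ) :
    pauliX * Matrix.diagonal ![a, b] * pauliX = Matrix.diagonal ![b, a] := by
  have h : ∀ a b : ℂ, Matrix.diagonal ![a, b] = !![a, 0; 0, b] := fun a b => by
    ext i j; fin_cases i <;> fin_cases j <;> rfl
  rw [h, h, pauliX]
  ext i j
  fin_cases i <;> fin_cases j <;> simp

/-- A traceless element of `SU(2)` is conjugate to `iZ`. -/
theorem exists_conj_eq_I_smul_pauliZ {M : OneQubit} (hM : M ∈ Matrix.unitaryGroup (Fin 2) ℂ)
    (hdet : M.det = 1) (htr : M.trace = 0) :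
    ∃ S ∈ Matrix.unitaryGroup (Fin 2) ℂ, S * M * S.conjTranspose = Complex.I • pauliZ := by
  -- In SU(2) the inverse is the adjugate (tr M)·1 − M, which is −M here.
  have hstar : M.conjTranspose = -M := by
    have h1 : M.conjTranspose = M.adjugate := by
      have h2 := Matrix.mul_adjugate M
      rw [hdet, one_smul] at h2
      have h3 := Matrix.mem_unitaryGroup_iff'.1 hM
      rw [Matrix.star_eq_conjTranspose] at h3
      calc M.conjTranspose = M.conjTranspose * (M * M.adjugate) := by rw [h2, mul_one]
        _ = M.adjugate := by rw [← mul_assoc, h3, one_mul]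
    rw [h1, Matrix.adjugate_fin_two]
    rw [Matrix.trace_fin_two] at htr
    ext a b
    fin_cases a <;> fin_cases b <;> simp
    · linear_combination htr
    · linear_combination htr
  -- `N` is Hermitian with trace 0 and determinant (−i)² = −1, so its eigenvalues are 1 and −1.
  set N : OneQubit := -Complex.I • M with hN
  have hMN : M = Complex.I • N := by
    rw [hN, smul_smul]
    simp
  have hNh : N.IsHermitian := by
    rw [Matrix.IsHermitian, hN, Matrix.conjTranspose_smul, hstar]
    simp
  obtain ⟨V, hVmem, hdiag⟩ : ∃ V ∈ Matrix.unitaryGroup (Fin 2) ℂ,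
      star V * N * V = Matrix.diagonal (RCLike.ofReal ∘ hNh.eigenvalues) :=
    ⟨hNh.eigenvectorUnitary.1, hNh.eigenvectorUnitary.2, by
      simpa using hNh.conjStarAlgAut_star_eigenvectorUnitary⟩
  have htrN : hNh.eigenvalues 0 + hNh.eigenvalues 1 = 0 := by
    have h : N.trace = 0 := by rw [hN, Matrix.trace_smul, htr, smul_zero]
    rw [hNh.trace_eq_sum_eigenvalues, Fin.sum_univ_two] at h
    simpa using congrArg Complex.re h
  have hdetN : hNh.eigenvalues 0 * hNh.eigenvalues 1 = -1 := by
    have h : N.det = -1 := by rw [hN, Matrix.det_smul, hdet]; simp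
    rw [hNh.det_eq_prod_eigenvalues, Fin.prod_univ_two] at h
    simpa using congrArg Complex.re h
  have hV' : star V ∈ Matrix.unitaryGroup (Fin 2) ℂ := Unitary.star_mem hVmem
  have h1 : hNh.eigenvalues 1 = -hNh.eigenvalues 0 := by linarith
  have h0 : hNh.eigenvalues 0 = 1 ∨ hNh.eigenvalues 0 = -1 := by
    rw [h1] at hdetN
    exact mul_self_eq_one_iff.1 (by linarith)
  rcases h0 with h0 | h0
  · refine ⟨star V, hV', ?_⟩
    rw [← Matrix.star_eq_conjTranspose, star_star, hMN, mul_smul_comm, smul_mul_assoc, hdiag,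
      pauliZ_eq_diagonal]
    congr 2
    funext a
    fin_cases a <;> simp [h0, h1]
  -- The eigenvalues come in the opposite order; X exchanges them.
  · refine ⟨pauliX * star V, mul_mem pauliX_mem hV', ?_⟩
    rw [← Matrix.star_eq_conjTranspose, star_mul, star_star, hMN, mul_smul_comm, smul_mul_assoc]
    have h2 : pauliX * star V * N * (V * star pauliX) =
        pauliX * (star V * N * V) * star pauliX := by simp only [mul_assoc]
    have h3 : (RCLike.ofReal ∘ hNh.eigenvalues : Fin 2 → ℂ) = ![-1, 1] := by
      funext a
      fin_cases a <;> simp [h0, h1]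
    rw [h2, hdiag, Matrix.star_eq_conjTranspose, pauliX_isHermitian.eq, h3,
      pauliX_mul_diagonal_mul_pauliX, pauliZ_eq_diagonal]

/-- The gate that applies `W b` to the first qubit when the second one is in the state `b`. -/
def multiplexer (W : Fin 2 → OneQubit) : TwoQubit :=
  Matrix.of fun x y => if x.2 = y.2 then W x.2 x.1 y.1 else 0

theorem multiplexer_mul (W V : Fin 2 → OneQubit) :
    multiplexer W * multiplexer V = multiplexer fun b => W b * V b := by
  ext ⟨a, b⟩ ⟨c, d⟩
  fin_cases b <;> fin_cases d <;>
    simp [multiplexer, Matrix.mul_apply, Fintype.sum_prod_type]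

theorem kronecker_diagonal_eq_multiplexer (A : OneQubit) (d : Fin 2 → ℂ) :
    A ⊗ₖ Matrix.diagonal d = multiplexer fun b => d b • A := by
  ext ⟨a, b⟩ ⟨c, e⟩
  fin_cases b <;> fin_cases e <;> simp [multiplexer, mul_comm]

theorem kronecker_one_eq_multiplexer (A : OneQubit) : A ⊗ₖ 1 = multiplexer fun _ => A := by
  rw [← Matrix.diagonal_one, kronecker_diagonal_eq_multiplexer]
  simp

theorem diagonal_isingPhases_eq_multiplexer (θ : ℝ) :
    Matrix.diagonal (isingPhases θ) = multiplexer ![rotationZ θ, rotationZ (-θ)] := by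
  ext ⟨a, b⟩ ⟨c, d⟩
  fin_cases a <;> fin_cases b <;> fin_cases c <;> fin_cases d <;>
    simp [multiplexer, rotationZ, isingPhases, Matrix.diagonal]

theorem controlledZ_eq_multiplexer : controlledZ = multiplexer ![1, pauliZ] := by
  ext ⟨a, b⟩ ⟨c, d⟩
  fin_cases a <;> fin_cases b <;> fin_cases c <;> fin_cases d <;>
    simp [multiplexer, controlledZ, pauliZ, Matrix.diagonal]

/-- The last multiple of `c` that does not exceed π/4; it is positive because `c` itself does not.
-/
theorem exists_nat_mul_angle {c : ℝ} (h0 : 0 < c) (h1 : c ≤ Real.pi / 4) :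
    ∃ k : ℕ, 0 < k * c ∧ k * c ≤ Real.pi / 4 ∧ Real.pi / 4 ≤ (k + 1) * c := by
  have hle : (⌊Real.pi / 4 / c⌋₊ : ℝ) ≤ Real.pi / 4 / c :=
    Nat.floor_le (by have := Real.pi_pos; positivity)
  have hlt := Nat.lt_floor_add_one (Real.pi / 4 / c)
  have hpos : 1 ≤ ⌊Real.pi / 4 / c⌋₊ := by
    rw [Nat.one_le_floor_iff, le_div_iff₀ h0]
    linarith
  refine ⟨⌊Real.pi / 4 / c⌋₊, ?_, (le_div_iff₀ h0).1 hle, ((div_lt_iff₀ h0).1 hlt).le⟩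
  have : (0 : ℝ) < ⌊Real.pi / 4 / c⌋₊ := by exact_mod_cast hpos
  positivity

/-- The required value of cos 2φ is cot 2c · cot 2b. It is nonnegative because both angles are in
(0, π/2], and at most 1 because 2c + 2b ≥ π/2 makes cos(2c + 2b) ≤ 0. -/
theorem exists_planeRotation_trace_eq_zero {c b : ℝ} (hc0 : 0 < c) (hc : c ≤ Real.pi / 4)
    (hb0 : 0 < b) (hb : b ≤ Real.pi / 4) (hcb : Real.pi / 4 ≤ b + c) :
    ∃ φ : ℝ, Real.cos (2 * c) * Real.cos (2 * b) =
      Real.sin (2 * c) * Real.sin (2 * b) * Real.cos (2 * φ) := by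
  have hs : 0 < Real.sin (2 * c) * Real.sin (2 * b) :=
    mul_pos (Real.sin_pos_of_pos_of_lt_pi (by linarith) (by linarith))
      (Real.sin_pos_of_pos_of_lt_pi (by linarith) (by linarith))
  have hcos : 0 ≤ Real.cos (2 * c) * Real.cos (2 * b) :=
    mul_nonneg (Real.cos_nonneg_of_mem_Icc ⟨by linarith, by linarith⟩)
      (Real.cos_nonneg_of_mem_Icc ⟨by linarith, by linarith⟩)
  have hle : Real.cos (2 * c) * Real.cos (2 * b) ≤ Real.sin (2 * c) * Real.sin (2 * b) := by
    have : Real.cos (2 * c + 2 * b) ≤ 0 :=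
      Real.cos_nonpos_of_pi_div_two_le_of_le (by linarith) (by linarith)
    rw [Real.cos_add] at this
    linarith
  refine ⟨Real.arccos (Real.cos (2 * c) * Real.cos (2 * b) /
    (Real.sin (2 * c) * Real.sin (2 * b))) / 2, ?_⟩
  rw [mul_div_cancel₀ _ two_ne_zero, Real.cos_arccos, mul_div_cancel₀ _ hs.ne']
  · exact (by norm_num : (-1 : ℝ) ≤ 0).trans (div_nonneg hcos hs.le)
  · exact (div_le_one hs).2 hle

/-- The one-qubit gates applied by two Ising interactions, the first of which is conjugated by `R`
on the first qubit, for the two states of the second qubit. -/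
def alternatingRotations (R : OneQubit) (c b : ℝ) : Fin 2 → OneQubit :=
  ![R * rotationZ c * R.conjTranspose * rotationZ b,
    R * rotationZ (-c) * R.conjTranspose * rotationZ (-b)]

theorem alternatingRotations_mem {R : OneQubit} (hR : R ∈ Matrix.unitaryGroup (Fin 2) ℂ) (c b : ℝ)
    (a : Fin 2) : alternatingRotations R c b a ∈ Matrix.unitaryGroup (Fin 2) ℂ := by
  have hR' := Unitary.star_mem hR
  fin_cases a <;>
    exact mul_mem (mul_mem (mul_mem hR (rotationZ_mem _)) hR') (rotationZ_mem _)

theorem det_alternatingRotations {R : OneQubit} (hR : R ∈ Matrix.unitaryGroup (Fin 2) ℂ) (c b : ℝ)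
    (a : Fin 2) : (alternatingRotations R c b a).det = 1 := by
  have h : R.det * R.conjTranspose.det = 1 := by
    rw [← Matrix.det_mul, ← Matrix.star_eq_conjTranspose, Matrix.mem_unitaryGroup_iff.1 hR,
      Matrix.det_one]
  have h2 : ∀ c b, (R * rotationZ c * R.conjTranspose * rotationZ b).det = 1 := fun c b => by
    rw [Matrix.det_mul, Matrix.det_mul, Matrix.det_mul, det_rotationZ, det_rotationZ, mul_one,
      mul_one, h]
  fin_cases a <;> exact h2 _ _

theorem multiplexer_alternatingRotations (R : OneQubit) (c b : ℝ) :
    multiplexer (alternatingRotations R c b) = (R ⊗ₖ 1) * Matrix.diagonal (isingPhases c) *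
      (R.conjTranspose ⊗ₖ 1) * Matrix.diagonal (isingPhases b) := by
  rw [kronecker_one_eq_multiplexer, kronecker_one_eq_multiplexer,
    diagonal_isingPhases_eq_multiplexer, diagonal_isingPhases_eq_multiplexer, multiplexer_mul,
    multiplexer_mul, multiplexer_mul]
  congr 1
  funext a
  fin_cases a <;> rfl

/-- The angles of `W₁` and of `W₀⁻¹` have equal signs, so in `W₁W₀⁻¹` the inner Z-rotations merge to
angle −2b, and by cyclicity of the trace the outer ones merge to −2c. -/
theorem trace_alternatingRotations (φ c b : ℝ) :
    (alternatingRotations (planeRotation φ) c b 1 *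
      (alternatingRotations (planeRotation φ) c b 0).conjTranspose).trace =
    2 * (Real.cos (2 * c) * Real.cos (2 * b) -
      Real.sin (2 * c) * Real.sin (2 * b) * Real.cos (2 * φ) : ℝ) := by
  obtain ⟨R, hR⟩ : ∃ R, R = planeRotation φ := ⟨_, rfl⟩
  have hRR : R.conjTranspose * R = 1 := by
    rw [hR]; exact Matrix.mem_unitaryGroup_iff'.1 (planeRotation_mem φ)
  have h3 : rotationZ (-(2 * b)) = rotationZ (-b) * rotationZ (-b) := by
    rw [rotationZ_mul]; ring_nf
  have h4 : rotationZ (-c) * rotationZ (-c) = rotationZ (-(2 * c)) := by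
    rw [rotationZ_mul]; ring_nf
  have h2 : alternatingRotations R c b 1 * (alternatingRotations R c b 0).conjTranspose =
      R * (rotationZ (-c) * R.conjTranspose * rotationZ (-(2 * b)) * R * rotationZ (-c)) *
        R.conjTranspose := by
    simp only [alternatingRotations, Matrix.cons_val_zero, Matrix.cons_val_one,
      Matrix.conjTranspose_mul, Matrix.conjTranspose_conjTranspose, rotationZ_conjTranspose, h3,
      mul_assoc]
  rw [← hR, h2, Matrix.trace_mul_comm, ← mul_assoc, hRR, one_mul, Matrix.trace_mul_comm,
    ← mul_assoc, ← mul_assoc, ← mul_assoc, h4, hR, trace_rotations, Real.cos_neg, Real.cos_neg,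
    Real.sin_neg, Real.sin_neg, neg_mul_neg]

/-- A gate that is `W₀` or `W₁` on the first qubit, depending on the second one, is equivalent to
the controlled-`Z` gate if `W₁ W₀⁻¹` is a traceless element of `SU(2)`. -/
theorem exists_controlledZ_eq {W : Fin 2 → OneQubit}
    (hW : ∀ a, W a ∈ Matrix.unitaryGroup (Fin 2) ℂ) (hdet : ∀ a, (W a).det = 1)
    (htr : (W 1 * (W 0).conjTranspose).trace = 0) :
    ∃ V ∈ Matrix.unitaryGroup (Fin 2) ℂ, ∃ d ∈ Matrix.unitaryGroup (Fin 2) ℂ,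
      ∃ V' ∈ Matrix.unitaryGroup (Fin 2) ℂ,
        controlledZ = (V ⊗ₖ d) * multiplexer W * (V' ⊗ₖ 1) := by
  have hW0 : W 0 * (W 0).conjTranspose = 1 := Matrix.mem_unitaryGroup_iff.1 (hW 0)
  obtain ⟨V, hV, hVM⟩ := exists_conj_eq_I_smul_pauliZ
    (mul_mem (hW 1) (Unitary.star_mem (hW 0)))
    (by rw [Matrix.star_eq_conjTranspose, Matrix.det_mul, Matrix.det_conjTranspose, hdet, hdet,
      star_one, one_mul]) htr
  rw [Matrix.star_eq_conjTranspose] at hVM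
  have hVV : V * V.conjTranspose = 1 := Matrix.mem_unitaryGroup_iff.1 hV
  -- The right factor normalizes the branch 0 to the identity and turns the branch 1 into iZ; the
  -- phase −i on the state 1 of the second qubit removes the i.
  refine ⟨V, hV, Matrix.diagonal ![1, -Complex.I],
    diagonal_mem_unitaryGroup fun a => by fin_cases a <;> simp,
    (W 0).conjTranspose * V.conjTranspose,
    mul_mem (Unitary.star_mem (hW 0)) (Unitary.star_mem hV), ?_⟩
  have h0 : V * W 0 * ((W 0).conjTranspose * V.conjTranspose) = 1 := by
    rw [mul_assoc, ← mul_assoc (W 0), hW0, one_mul, hVV]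
  have h1 : V * W 1 * ((W 0).conjTranspose * V.conjTranspose) = Complex.I • pauliZ := by
    rw [← hVM]; simp only [mul_assoc]
  rw [controlledZ_eq_multiplexer, kronecker_diagonal_eq_multiplexer, kronecker_one_eq_multiplexer,
    multiplexer_mul, multiplexer_mul]
  congr 1
  funext a
  rw [smul_mul_assoc, smul_mul_assoc]
  fin_cases a
  · simp only [Fin.zero_eta, h0, Matrix.cons_val_zero, one_smul]
  · simp only [Fin.mk_one, h1, Matrix.cons_val_one, Matrix.cons_val_fin_one, smul_smul, neg_mul,
      Complex.I_mul_I, neg_neg, one_smul]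

/-- The strict inequality τ < π/2 is what makes the interaction angle c = π/4 − τ/2 positive; the
second angle is b = kc. -/
theorem exists_implementsPair_controlledZ {S : Set TwoQubit} (hS : ∀ g, IsMatchgate g → g ∈ S)
    {τ : ℝ} (h0 : 0 ≤ τ) (h1 : τ < Real.pi / 2) (hτ : swapFamily τ ∈ S) :
    ∃ s, ImplementsPair S s controlledZ := by
  obtain ⟨c, hc⟩ : ∃ c, c = Real.pi / 4 - τ / 2 := ⟨_, rfl⟩
  obtain ⟨k, hk0, hk1, hk2⟩ := exists_nat_mul_angle (c := c) (by linarith) (by linarith)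
  obtain ⟨φ, hφ⟩ := exists_planeRotation_trace_eq_zero (c := c) (b := k * c) (by linarith)
    (by linarith) hk0 hk1 (by linarith)
  have hR := planeRotation_mem φ
  obtain ⟨V, hV, d, hd, V', hV', h⟩ := exists_controlledZ_eq
    (alternatingRotations_mem hR c (k * c)) (det_alternatingRotations hR c (k * c))
    (by rw [trace_alternatingRotations, hφ, sub_self, Complex.ofReal_zero, mul_zero])
  have h1' : (1 : OneQubit) ∈ Matrix.unitaryGroup (Fin 2) ℂ := one_mem _
  have hR' : (planeRotation φ).conjTranspose ∈ Matrix.unitaryGroup (Fin 2) ℂ := Unitary.star_mem hR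
  have hc1 := implementsPair_ising hS hτ 1
  have hck := implementsPair_ising hS hτ k
  rw [← hc] at hc1 hck
  rw [Nat.cast_one, one_mul c] at hc1
  have hW := (((ImplementsPair.kronecker hS hR h1').mul hc1).mul
    (ImplementsPair.kronecker hS hR' h1')).mul hck
  rw [← multiplexer_alternatingRotations] at hW
  have hCZ := ((ImplementsPair.kronecker hS hV hd).mul hW).mul (ImplementsPair.kronecker hS hV' h1')
  rw [← h] at hCZ
  exact ⟨_, hCZ⟩

/-! ## Controlled-`Z` gates at a distance -/

/-- The gate that exchanges two qubits. -/
def swapGate : TwoQubit := Matrix.of fun x y => if x = y.swap then 1 else 0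

theorem hadamard_conj_controlledZ_left :
    (hadamard ⊗ₖ 1) * controlledZ * (hadamard ⊗ₖ 1) = multiplexer ![1, pauliX] := by
  rw [kronecker_one_eq_multiplexer, controlledZ_eq_multiplexer, multiplexer_mul, multiplexer_mul]
  congr 1
  funext a
  fin_cases a <;> simp [hadamard_mul_self, hadamard_mul_pauliZ_mul_hadamard]

theorem controlledZ_submatrix_swap : controlledZ.submatrix Prod.swap Prod.swap = controlledZ := by
  ext ⟨a, b⟩ ⟨c, d⟩
  fin_cases a <;> fin_cases b <;> fin_cases c <;> fin_cases d <;>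
    simp [controlledZ, Matrix.diagonal]

theorem hadamard_conj_controlledZ_right :
    (1 ⊗ₖ hadamard) * controlledZ * (1 ⊗ₖ hadamard) =
      (multiplexer ![1, pauliX]).submatrix Prod.swap Prod.swap := by
  have h : (1 : OneQubit) ⊗ₖ hadamard = (hadamard ⊗ₖ 1).submatrix Prod.swap Prod.swap := by
    ext ⟨a, b⟩ ⟨c, d⟩
    simp [mul_comm]
  have hb : Function.Bijective (Prod.swap : Fin 2 × Fin 2 → Fin 2 × Fin 2) := Prod.swap_bijective
  rw [← hadamard_conj_controlledZ_left, Matrix.submatrix_mul _ _ _ _ _ hb,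
    Matrix.submatrix_mul _ _ _ _ _ hb, controlledZ_submatrix_swap, h]

/-- SWAP is three CNOTs with alternating targets, and a CNOT is CZ conjugated by a Hadamard gate on
its target. -/
theorem swapGate_eq : swapGate =
    ((hadamard ⊗ₖ 1) * controlledZ * (hadamard ⊗ₖ 1)) *
      ((1 ⊗ₖ hadamard) * controlledZ * (1 ⊗ₖ hadamard)) *
      ((hadamard ⊗ₖ 1) * controlledZ * (hadamard ⊗ₖ 1)) := by
  rw [hadamard_conj_controlledZ_left, hadamard_conj_controlledZ_right]
  ext ⟨a, b⟩ ⟨c, d⟩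
  fin_cases a <;> fin_cases b <;> fin_cases c <;> fin_cases d <;>
    simp [swapGate, multiplexer, pauliX, Matrix.mul_apply, Fintype.sum_prod_type]

theorem swapGate_mul_self : swapGate * swapGate = 1 := by
  ext ⟨a, b⟩ ⟨c, d⟩
  fin_cases a <;> fin_cases b <;> fin_cases c <;> fin_cases d <;>
    simp [swapGate, Matrix.mul_apply]

theorem exists_implementsPair_swapGate {S : Set TwoQubit} (hS : ∀ g, IsMatchgate g → g ∈ S)
    {s : ℕ} (h : ImplementsPair S s controlledZ) : ∃ t, ImplementsPair S t swapGate := by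
  have hl := ImplementsPair.kronecker hS hadamard_mem (one_mem (Matrix.unitaryGroup (Fin 2) ℂ))
  have hr := ImplementsPair.kronecker hS (one_mem (Matrix.unitaryGroup (Fin 2) ℂ)) hadamard_mem
  rw [swapGate_eq]
  exact ⟨_, (((hl.mul h).mul hl).mul ((hr.mul h).mul hr)).mul ((hl.mul h).mul hl)⟩

theorem onPair_swapGate_mul_apply {m : Type*} {i j : Fin n} (h : i ≠ j)
    (M : Matrix (Fin n → Fin 2) m ℂ) (x : Fin n → Fin 2) (y : m) :
    (onPair i j swapGate * M) x y = M (setPair i j x (x j, x i)) y := by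
  rw [onPair_mul_apply h, Finset.sum_eq_single (x j, x i)]
  · simp [swapGate]
  · intro p _ hp
    rw [swapGate, Matrix.of_apply, if_neg, zero_mul]
    intro hc
    exact hp (by rw [← Prod.swap_swap p, ← hc]; rfl)
  · simp

theorem onPair_swapGate_conj_diagonal {i j : Fin n} (h : i ≠ j) (e : (Fin n → Fin 2) → ℂ) :
    onPair i j swapGate * Matrix.diagonal e * onPair i j swapGate =
      Matrix.diagonal fun x => e (setPair i j x (x j, x i)) := by
  have h2 : onPair i j swapGate * Matrix.diagonal e =
      (Matrix.diagonal fun x => e (setPair i j x (x j, x i))) * onPair i j swapGate := by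
    ext x y
    conv_rhs => rw [← Matrix.mul_one (onPair i j swapGate)]
    rw [Matrix.diagonal_mul, onPair_swapGate_mul_apply h, onPair_swapGate_mul_apply h,
      Matrix.one_apply, Matrix.diagonal_apply]
    split_ifs <;> simp
  rw [h2, mul_assoc, onPair_mul h, swapGate_mul_self, onPair_one, mul_one]

theorem onPair_controlledZ (i j : Fin n) : onPair i j controlledZ =
    Matrix.diagonal fun x => if x i = 1 ∧ x j = 1 then -1 else 1 := by
  rw [controlledZ, onPair_diagonal]
  simp only [Prod.mk.injEq]

theorem onPair_controlledZ_comm (i j : Fin n) : onPair i j controlledZ = onPair j i controlledZ := by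
  rw [onPair_controlledZ, onPair_controlledZ]
  simp only [and_comm]

/-- Swap qubit `j` with its left neighbour, apply CZ at the shorter distance, and swap back: every
unit of distance costs two swaps. -/
theorem implements_controlledZ_of_lt {S : Set TwoQubit} {s t : ℕ}
    (hs : ImplementsPair S s controlledZ) (ht : ImplementsPair S t swapGate) (d : ℕ) {i j : Fin n}
    (hij : (j : ℕ) = i + 1 + d) : Implements S (s + d * (2 * t)) (onPair i j controlledZ) := by
  induction d generalizing j with
  | zero => simpa using hs n i j hij
  | succ d ih =>
    have hlt : (i : ℕ) + 1 + d < n := by have := j.2; omega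
    let l : Fin n := ⟨i + 1 + d, hlt⟩
    have hl : (j : ℕ) = l + 1 := by simp only [l]; omega
    have hlj : l ≠ j := by rintro h; rw [h] at hl; omega
    have hli : i ≠ l := fun h => by have := congrArg Fin.val h; simp only [l] at this; omega
    have hij' : i ≠ j := by rintro rfl; omega
    have h := ((ht n l j hl).mul (ih (j := l) rfl)).mul (ht n l j hl)
    rw [onPair_controlledZ, onPair_swapGate_conj_diagonal hlj] at h
    simp only [setPair_left hlj, setPair_of_ne hli hij'] at h
    rw [onPair_controlledZ]
    exact h.mono (le_of_eq (by ring))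

theorem implements_controlledZ {S : Set TwoQubit} {s t : ℕ}
    (hs : ImplementsPair S s controlledZ) (ht : ImplementsPair S t swapGate) {i j : Fin n}
    (hij : i ≠ j) : Implements S (s + n * (2 * t)) (onPair i j controlledZ) := by
  wlog hlt : i < j generalizing i j
  · rw [onPair_controlledZ_comm]
    exact this hij.symm (lt_of_le_of_ne (not_lt.1 hlt) hij.symm)
  · have hd : (j : ℕ) = i + 1 + (j - i - 1) := by have : (i : ℕ) < j := hlt; omega
    refine (implements_controlledZ_of_lt hs ht _ hd).mono ?_
    gcongr
    have := j.2
    omega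

theorem hasPolynomialOverheadUnder_pairEncoding {S : Set TwoQubit}
    (hS : ∀ g, IsMatchgate g → g ∈ S) {s t : ℕ} (hs : ImplementsPair S s controlledZ)
    (ht : ImplementsPair S t swapGate) : HasPolynomialOverheadUnder S pairEncoding := by
  -- Each standard gate costs at most s + 1 + 2tn gates; both `n` and the number of gates are
  -- bounded by the argument of the polynomial.
  refine ⟨Polynomial.X * (Polynomial.C (s + 1) + Polynomial.X * Polynomial.C (2 * t)),
    fun n m U hU => ?_⟩
  obtain ⟨L, rfl, hL, rfl⟩ := hU
  have hgate : ∀ A ∈ L, Implements S (s + 1 + n * (2 * t)) A := by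
    intro A hA
    rcases hL A hA with ⟨i, B, hB, rfl⟩ | ⟨i, j, hij, rfl⟩
    · exact (implements_onQubit hS i hB).mono (by omega)
    · exact (implements_controlledZ hs ht hij).mono (by omega)
  have h := (Implements.list_prod hgate).mono (t := Polynomial.eval (n + L.length)
    (Polynomial.X * (Polynomial.C (s + 1) + Polynomial.X * Polynomial.C (2 * t)))) (by
      simp only [Polynomial.eval_mul, Polynomial.eval_X, Polynomial.eval_add, Polynomial.eval_C]
      gcongr <;> omega)
  obtain ⟨s', hs', C, z, hC⟩ := h
  exact ⟨s', C, z, hs', hC⟩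

end
end Matchgate

namespace Matchgate
noncomputable section

/-! ## One-parameter subgroups of closed submonoids -/

section Trotter
open NormedSpace Filter Topology

/-- Telescoping: the errors of `m` contractive steps add up. -/
theorem norm_pow_sub_pow_le {A : Type*} [NormedRing A] [NormOneClass A] {a b : A} (ha : ‖a‖ ≤ 1)
    (hb : ‖b‖ ≤ 1) (m : ℕ) : ‖a ^ m - b ^ m‖ ≤ m * ‖a - b‖ := by
  induction m with
  | zero => simp
  | succ m ih =>
    have h : a ^ (m + 1) - b ^ (m + 1) = a ^ m * (a - b) + (a ^ m - b ^ m) * b := by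
      rw [pow_succ, pow_succ]; noncomm_ring
    calc ‖a ^ (m + 1) - b ^ (m + 1)‖ ≤ ‖a ^ m‖ * ‖a - b‖ + ‖a ^ m - b ^ m‖ * ‖b‖ := by
          rw [h]
          exact (norm_add_le _ _).trans (add_le_add (norm_mul_le _ _) (norm_mul_le _ _))
      _ ≤ 1 * ‖a - b‖ + m * ‖a - b‖ * 1 := by
          have : ‖a ^ m‖ ≤ 1 := (norm_pow_le a m).trans (pow_le_one₀ (norm_nonneg a) ha)
          gcongr
      _ = (m + 1 : ℕ) * ‖a - b‖ := by push_cast; ring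

variable {A : Type*} [CStarAlgebra A]

theorem exp_real_smul_mem_unitary {x : A} (hx : x ∈ skewAdjoint A) (t : ℝ) :
    exp (t • x) ∈ unitary A := by
  let _ : NormedAlgebra ℚ A := NormedAlgebra.restrictScalars ℚ ℂ A
  exact exp_mem_unitary_of_mem_skewAdjoint (skewAdjoint.smul_mem t hx)

/-- Lie–Trotter formula. The two curves agree to first order at 0, so one step of length 1/m has
error o(1/m), and `m` steps with unitary factors have error o(1). -/
theorem tendsto_exp_mul_exp_pow {x y : A} (hx : x ∈ skewAdjoint A) (hy : y ∈ skewAdjoint A) :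
    Tendsto (fun m : ℕ => (exp ((m : ℝ)⁻¹ • x) * exp ((m : ℝ)⁻¹ • y)) ^ m) atTop
      (𝓝 (exp (x + y))) := by
  let _ : NormedAlgebra ℚ A := NormedAlgebra.restrictScalars ℚ ℂ A
  -- The zero algebra is set apart because the estimates below need ‖1‖ = 1.
  rcases subsingleton_or_nontrivial A with hA | hA
  · exact tendsto_const_nhds.congr fun m => Subsingleton.elim _ _
  have hderiv : HasDerivAt (fun t : ℝ => exp (t • x) * exp (t • y) - exp (t • (x + y))) 0 0 := by
    have h := ((hasDerivAt_exp_smul_const (𝕂 := ℝ) x 0).mul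
      (hasDerivAt_exp_smul_const (𝕂 := ℝ) y 0)).sub
      (hasDerivAt_exp_smul_const (𝕂 := ℝ) (x + y) 0)
    exact h.congr_deriv (by simp)
  have h0 : Tendsto (fun m : ℕ => (m : ℝ) * ‖exp ((m : ℝ)⁻¹ • x) * exp ((m : ℝ)⁻¹ • y) -
      exp ((m : ℝ)⁻¹ • (x + y))‖) atTop (𝓝 0) := by
    have hlim : Tendsto (fun m : ℕ => ((m : ℝ))⁻¹) atTop (𝓝[≠] 0) := by
      refine tendsto_nhdsWithin_iff.2 ⟨tendsto_inv_atTop_nhds_zero_nat, ?_⟩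
      filter_upwards [eventually_gt_atTop 0] with m hm
      have : (m : ℝ) ≠ 0 := by positivity
      simpa using hm.ne'
    have h := (hasDerivAt_iff_tendsto_slope.1 hderiv).comp hlim
    have h2 := h.norm
    simp only [norm_zero] at h2
    refine h2.congr fun m => ?_
    simp [slope, norm_smul]
  rw [tendsto_iff_norm_sub_tendsto_zero]
  refine squeeze_zero' (Eventually.of_forall fun m => norm_nonneg _) ?_ h0
  filter_upwards [eventually_gt_atTop 0] with m hm
  have hm' : (m : ℝ) ≠ 0 := by positivity
  have hpow : exp (x + y) = exp ((m : ℝ)⁻¹ • (x + y)) ^ m := by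
    rw [← exp_nsmul, ← Nat.cast_smul_eq_nsmul ℝ, smul_smul, mul_inv_cancel₀ hm', one_smul]
  rw [hpow]
  refine norm_pow_sub_pow_le ?_ ?_ m
  · exact (CStarRing.norm_of_mem_unitary (mul_mem (exp_real_smul_mem_unitary hx _)
      (exp_real_smul_mem_unitary hy _))).le
  · exact (CStarRing.norm_of_mem_unitary (exp_real_smul_mem_unitary (add_mem hx hy) _)).le

theorem exp_add_mem {G : Submonoid A} (hG : IsClosed (G : Set A)) {x y : A}
    (hx : x ∈ skewAdjoint A) (hy : y ∈ skewAdjoint A) (hxG : ∀ t : ℝ, exp (t • x) ∈ G)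
    (hyG : ∀ t : ℝ, exp (t • y) ∈ G) (t : ℝ) : exp (t • (x + y)) ∈ G := by
  rw [smul_add]
  refine hG.mem_of_tendsto (tendsto_exp_mul_exp_pow (skewAdjoint.smul_mem t hx)
    (skewAdjoint.smul_mem t hy)) (Eventually.of_forall fun m => pow_mem (mul_mem ?_ ?_) m)
  · rw [smul_smul]; exact hxG _
  · rw [smul_smul]; exact hyG _

end Trotter

open NormedSpace

/-- `H` is arg(U) in the continuous functional calculus; the jump of arg is harmless because the
spectrum is finite. -/
theorem exists_isHermitian_exp_eq {ι : Type*} [Fintype ι] [DecidableEq ι] {U : Matrix ι ι ℂ}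
    (hU : U ∈ Matrix.unitaryGroup ι ℂ) :
    ∃ H : Matrix ι ι ℂ, H.IsHermitian ∧ exp (Complex.I • H) = U := by
  have hn : IsStarNormal U := ⟨by
    rw [commute_iff_eq, Matrix.mem_unitaryGroup_iff.1 hU, Matrix.mem_unitaryGroup_iff'.1 hU]⟩
  have hcont : ∀ f : ℂ → ℂ, ContinuousOn f (spectrum ℂ U) := fun f =>
    (Matrix.finite_spectrum U).continuousOn f
  refine ⟨cfc (Complex.ofReal ∘ Complex.arg : ℂ → ℂ) U, ?_, ?_⟩
  · exact IsSelfAdjoint.cfc_arg U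
  · rw [← cfc_const_mul Complex.I _ U (hcont _), ← CFC.exp_eq_normedSpace_exp (𝕜 := ℂ),
      ← cfc_comp' _ _ U (by fun_prop) (hcont _)]
    conv_rhs => rw [← cfc_id' ℂ U]
    refine cfc_congr fun z hz => ?_
    have hz1 : ‖z‖ = 1 := spectrum.norm_eq_one_of_unitary hU hz
    have := Complex.norm_mul_exp_arg_mul_I z
    rw [hz1, Complex.ofReal_one, one_mul] at this
    rw [← Complex.exp_eq_exp_ℂ, Function.comp_apply, mul_comm, this]

variable {n : ℕ}

/-- The Hermitian generators of the one-parameter groups in a closed submonoid. -/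
def hermitianGenerators (G : Submonoid (Operator n)) (hG : IsClosed (G : Set (Operator n))) :
    Submodule ℝ (Operator n) where
  carrier := {H | H.IsHermitian ∧ ∀ t : ℝ, exp (t • Complex.I • H) ∈ G}
  zero_mem' := ⟨Matrix.isHermitian_zero, fun t => by
    rw [smul_zero, smul_zero, exp_zero]; exact one_mem G⟩
  add_mem' := by
    rintro H K ⟨hH, hHG⟩ ⟨hK, hKG⟩
    refine ⟨hH.add hK, fun t => ?_⟩
    rw [smul_add]
    exact exp_add_mem hG (skewAdjoint.mem_iff.2 (by simp [Matrix.star_eq_conjTranspose, hH.eq]))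
      (skewAdjoint.mem_iff.2 (by simp [Matrix.star_eq_conjTranspose, hK.eq])) hHG hKG t
  smul_mem' := by
    rintro r H ⟨hH, hHG⟩
    refine ⟨?_, fun t => ?_⟩
    · rw [Matrix.IsHermitian, Matrix.conjTranspose_smul, hH.eq, star_trivial]
    · rw [smul_comm Complex.I r H, smul_smul]
      exact hHG _

/-! ### Density of the group generated by one-qubit and controlled-Z gates -/

section Density

variable {G : Submonoid (Operator n)} {hG : IsClosed (G : Set (Operator n))}

theorem conj_mem_hermitianGenerators {H U : Operator n} (hH : H ∈ hermitianGenerators G hG)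
    (hU : U ∈ G) (hU' : U.conjTranspose ∈ G) (hUU : U ∈ Matrix.unitaryGroup (Fin n → Fin 2) ℂ) :
    U * H * U.conjTranspose ∈ hermitianGenerators G hG := by
  refine ⟨Matrix.isHermitian_mul_mul_conjTranspose U hH.1, fun t => ?_⟩
  have h1 : U * U.conjTranspose = 1 := Matrix.mem_unitaryGroup_iff.1 hUU
  have hinv : U⁻¹ = U.conjTranspose := Matrix.inv_eq_right_inv h1
  have h : t • Complex.I • (U * H * U.conjTranspose) = U * (t • Complex.I • H) * U⁻¹ := by
    rw [hinv]
    simp only [Matrix.mul_smul, Matrix.smul_mul]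
  rw [h, Matrix.exp_conj U _ ((Unitary.toUnits ⟨U, hUU⟩).isUnit), hinv]
  exact mul_mem (mul_mem hU (hH.2 t)) hU'

theorem one_mem_hermitianGenerators (hphase : ∀ z : ℂ, ‖z‖ = 1 → z • (1 : Operator n) ∈ G) :
    (1 : Operator n) ∈ hermitianGenerators G hG := by
  refine ⟨Matrix.isHermitian_one, fun t => ?_⟩
  have h : exp (t • Complex.I • (1 : Operator n)) =
      Complex.exp (Complex.I * t) • (1 : Operator n) := by
    have h2 : t • Complex.I • (1 : Operator n) = Matrix.diagonal fun _ => Complex.I * t := by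
      rw [← Matrix.diagonal_one, ← Matrix.diagonal_smul, ← Matrix.diagonal_smul]
      congr 1
      funext x
      simp [mul_comm]
    rw [h2, Matrix.exp_diagonal, ← Matrix.diagonal_one, ← Matrix.diagonal_smul]
    congr 1
    funext x
    rw [Pi.coe_exp, ← Complex.exp_eq_exp_ℂ]
    simp
  rw [h]
  exact hphase _ (norm_exp_I_mul_ofReal t)

theorem onQubit_mem_hermitianGenerators
    (hlocal : ∀ (i : Fin n), ∀ B ∈ Matrix.unitaryGroup (Fin 2) ℂ, onQubit i B ∈ G) (i : Fin n)
    {A : OneQubit} (hA : A.IsHermitian) : onQubit i A ∈ hermitianGenerators G hG := by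
  refine ⟨?_, fun t => ?_⟩
  · rw [Matrix.IsHermitian, onQubit_conjTranspose, hA.eq]
  · have h : t • Complex.I • onQubit i A = onQubitHom i (t • Complex.I • A) := by
      rw [← onQubitHom_apply, ← Complex.coe_smul, ← Complex.coe_smul, map_smul, map_smul]
    let _ : NormedAlgebra ℚ OneQubit := NormedAlgebra.restrictScalars ℚ ℂ OneQubit
    have hc : Continuous (onQubitHom (n := n) i) :=
      (onQubitHom (n := n) i).toLinearMap.continuous_of_finiteDimensional
    rw [h, ← map_exp (onQubitHom i) hc]
    refine hlocal i _ (exp_real_smul_mem_unitary (skewAdjoint.mem_iff.2 ?_) t)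
    simp [Matrix.star_eq_conjTranspose, hA.eq]

theorem pureTensor_mem_unitaryGroup {f : Fin n → OneQubit}
    (hf : ∀ i, f i ∈ Matrix.unitaryGroup (Fin 2) ℂ) :
    pureTensor f ∈ Matrix.unitaryGroup (Fin n → Fin 2) ℂ := by
  rw [Matrix.mem_unitaryGroup_iff, Matrix.star_eq_conjTranspose, pureTensor_conjTranspose,
    pureTensor_mul, ← pureTensor_one]
  congr 1
  funext i
  exact Matrix.mem_unitaryGroup_iff.1 (hf i)

theorem pureTensor_mem
    (hlocal : ∀ (i : Fin n), ∀ B ∈ Matrix.unitaryGroup (Fin 2) ℂ, onQubit i B ∈ G)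
    {f : Fin n → OneQubit} (hf : ∀ i, f i ∈ Matrix.unitaryGroup (Fin 2) ℂ) : pureTensor f ∈ G := by
  have h : ∀ s : Finset (Fin n), pureTensor (fun i => if i ∈ s then f i else 1) ∈ G := by
    intro s
    induction s using Finset.induction_on with
    | empty => simp [pureTensor_one]
    | insert i s hi ih =>
      have h2 : pureTensor (fun l => if l ∈ insert i s then f l else 1) =
          onQubit i (f i) * pureTensor (fun l => if l ∈ s then f l else 1) := by
        rw [onQubit_mul_pureTensor]
        congr 1
        funext l
        by_cases hl : l = i
        · subst hl; simp [hi]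
        · simp [hl]
      rw [h2]
      exact mul_mem (hlocal i _ (hf i)) ih
  simpa using h Finset.univ

/-- The two-qubit identity CZ (X ⊗ 1) CZ = X ⊗ Z: conjugation by CZ extends a Pauli string by one
site. -/
theorem controlledZ_conj_pureTensor {i j : Fin n} (hij : i ≠ j) {f : Fin n → OneQubit}
    (hi : f i = pauliX) (hj : f j = 1) :
    onPair i j controlledZ * pureTensor f * onPair i j controlledZ =
      pureTensor (Function.update f j pauliZ) := by
  ext x y
  rw [onPair_controlledZ, Matrix.mul_diagonal, Matrix.diagonal_mul, pureTensor_update_apply]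
  have h : pureTensor f x y =
      f j (x j) (y j) * ∏ l ∈ Finset.univ.erase j, f l (x l) (y l) := by
    rw [← pureTensor_update_apply, Function.update_eq_self]
  rw [h, hj, ← Finset.mul_prod_erase _ _ (Finset.mem_erase.2 ⟨hij, Finset.mem_univ i⟩), hi]
  have key : ∀ a b c d : Fin 2, (if a = 1 ∧ b = 1 then (-1 : ℂ) else 1) *
      ((1 : OneQubit) b d * pauliX a c) * (if c = 1 ∧ d = 1 then -1 else 1) =
      pauliZ b d * pauliX a c := by
    intro a b c d
    fin_cases a <;> fin_cases b <;> fin_cases c <;> fin_cases d <;> simp [pauliX, pauliZ]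
  rw [← mul_assoc ((1 : OneQubit) _ _), ← mul_assoc, mul_right_comm, key, mul_assoc]

/-- The four Pauli matrices, including the identity. -/
def pauli : Fin 4 → OneQubit := ![1, pauliX, pauliY, pauliZ]

theorem pauli_isHermitian (a : Fin 4) : (pauli a).IsHermitian := by
  fin_cases a
  exacts [Matrix.isHermitian_one, pauliX_isHermitian, pauliY_isHermitian, pauliZ_isHermitian]

theorem eq_sum_pauli (A : OneQubit) :
    ∃ r : Fin 4 → ℂ, A = ∑ a, r a • pauli a := by
  refine ⟨![(A 0 0 + A 1 1) / 2, (A 0 1 + A 1 0) / 2, Complex.I * (A 0 1 - A 1 0) / 2,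
    (A 0 0 - A 1 1) / 2], ?_⟩
  have hI := Complex.I_mul_I
  ext a b
  fin_cases a <;> fin_cases b <;>
    simp [Fin.sum_univ_four, pauli, pauliX, pauliY, pauliZ]
  · ring
  · linear_combination (A 0 1 - A 1 0) / 2 * hI
  · linear_combination (A 1 0 - A 0 1) / 2 * hI
  · ring

theorem exists_conj_pauliX {a : Fin 4} (ha : a ≠ 0) :
    ∃ B ∈ Matrix.unitaryGroup (Fin 2) ℂ, B * pauliX * B.conjTranspose = pauli a := by
  fin_cases a
  · exact absurd rfl ha
  · exact ⟨1, one_mem _, by simp [pauli]⟩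
  · refine ⟨_, phaseGate_mem, ?_⟩
    rw [Matrix.diagonal_conjTranspose]
    ext i j
    rw [Matrix.mul_diagonal, Matrix.diagonal_mul]
    fin_cases i <;> fin_cases j <;> simp [pauli, pauliX, pauliY]
  · exact ⟨_, hadamard_mem, by
      rw [hadamard_isHermitian.eq, hadamard_mul_pauliX_mul_hadamard]; rfl⟩

theorem exists_conj_pauliZ {a : Fin 4} (ha : a ≠ 0) :
    ∃ B ∈ Matrix.unitaryGroup (Fin 2) ℂ, B * pauliZ * B.conjTranspose = pauli a := by
  obtain ⟨B, hB, h⟩ := exists_conj_pauliX ha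
  refine ⟨B * hadamard, mul_mem hB hadamard_mem, ?_⟩
  rw [← h, Matrix.conjTranspose_mul, hadamard_isHermitian.eq, ← hadamard_mul_pauliZ_mul_hadamard]
  simp only [mul_assoc]

/-- Starting from the local generator X at `i`, conjugation by CZ on `i` and `j` attaches a Z at
each `j` of `s`. -/
theorem pureTensor_pauliX_pauliZ_mem_hermitianGenerators
    (hlocal : ∀ (i : Fin n), ∀ B ∈ Matrix.unitaryGroup (Fin 2) ℂ, onQubit i B ∈ G)
    (hcz : ∀ i j : Fin n, i ≠ j → onPair i j controlledZ ∈ G) (i : Fin n) (s : Finset (Fin n))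
    (hi : i ∉ s) :
    pureTensor (fun l => if l = i then pauliX else if l ∈ s then pauliZ else 1) ∈
      hermitianGenerators G hG := by
  induction s using Finset.induction_on with
  | empty =>
    have h := onQubit_mem_hermitianGenerators (hG := hG) hlocal i pauliX_isHermitian
    rw [onQubit_eq_pureTensor] at h
    convert h using 2
    funext l
    by_cases hl : l = i
    · subst hl; simp
    · simp [hl]
  | insert j s hj ih =>
    rw [Finset.mem_insert, not_or] at hi
    have hsa : (onPair i j controlledZ).conjTranspose = onPair i j controlledZ := by
      rw [onPair_controlledZ, Matrix.diagonal_conjTranspose]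
      congr 1
      funext x
      rw [Pi.star_apply]
      split_ifs <;> simp
    have hsq : onPair i j controlledZ * onPair i j controlledZ = 1 := by
      rw [onPair_controlledZ, Matrix.diagonal_mul_diagonal, ← Matrix.diagonal_one]
      congr 1
      funext x
      split_ifs <;> simp
    have hmem := hcz i j hi.1
    have h := conj_mem_hermitianGenerators (ih hi.2) hmem (hsa.symm ▸ hmem)
      (mem_unitaryGroup_of_isHermitian hsa hsq)
    rw [hsa, controlledZ_conj_pureTensor hi.1 (by simp) (by simp [Ne.symm hi.1, hj])] at h
    convert h using 2
    funext l
    by_cases hl : l = j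
    · subst hl; simp [Ne.symm hi.1]
    · simp [hl]

/-- A nontrivial string is a local conjugate of an X at one site of its support and Z's at the
others; the trivial string generates the global phases. -/
theorem pureTensor_pauli_mem_hermitianGenerators
    (hphase : ∀ z : ℂ, ‖z‖ = 1 → z • (1 : Operator n) ∈ G)
    (hlocal : ∀ (i : Fin n), ∀ B ∈ Matrix.unitaryGroup (Fin 2) ℂ, onQubit i B ∈ G)
    (hcz : ∀ i j : Fin n, i ≠ j → onPair i j controlledZ ∈ G) (κ : Fin n → Fin 4) :
    pureTensor (fun i => pauli (κ i)) ∈ hermitianGenerators G hG := by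
  by_cases h : ∃ i, κ i ≠ 0
  · obtain ⟨i, hi⟩ := h
    have hB : ∀ l, ∃ B ∈ Matrix.unitaryGroup (Fin 2) ℂ,
        B * (if l = i then pauliX else if l ∈ Finset.univ.filter (fun l => κ l ≠ 0 ∧ l ≠ i) then
          pauliZ else 1) * B.conjTranspose = pauli (κ l) := by
      intro l
      by_cases hl : l = i
      · subst hl; simpa using exists_conj_pauliX hi
      · by_cases h0 : κ l = 0
        · refine ⟨1, one_mem _, ?_⟩
          simp [hl, h0, pauli]
        · simpa [hl, h0] using exists_conj_pauliZ h0
    choose B hB hBeq using hB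
    have h := conj_mem_hermitianGenerators
      (pureTensor_pauliX_pauliZ_mem_hermitianGenerators (hG := hG) hlocal hcz i
        (Finset.univ.filter fun l => κ l ≠ 0 ∧ l ≠ i) (by simp))
      (pureTensor_mem hlocal hB) (by
        rw [pureTensor_conjTranspose]
        exact pureTensor_mem hlocal fun l => Unitary.star_mem (hB l))
      (pureTensor_mem_unitaryGroup hB)
    rw [pureTensor_conjTranspose, pureTensor_mul, pureTensor_mul] at h
    simpa only [hBeq] using h
  · push Not at h
    have h1 : (fun i => pauli (κ i)) = fun _ => 1 := by
      funext i
      rw [h i]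
      rfl
    rw [h1, pureTensor_one]
    exact one_mem_hermitianGenerators hphase

/-- The operators all of whose multiples have a Hermitian part in a given real subspace. -/
def complexification (L : Submodule ℝ (Operator n)) : Submodule ℂ (Operator n) where
  carrier := {M | ∀ c : ℂ, c • M + (c • M).conjTranspose ∈ L}
  zero_mem' := fun c => by simp
  add_mem' := fun {M N} hM hN c => by
    rw [smul_add, Matrix.conjTranspose_add, add_add_add_comm]
    exact add_mem (hM c) (hN c)
  smul_mem' := fun r M hM c => by
    rw [smul_smul]
    exact hM _

theorem mem_complexification_of_isHermitian {L : Submodule ℝ (Operator n)} {H : Operator n}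
    (hH : H.IsHermitian) (hL : H ∈ L) : H ∈ complexification L := fun c => by
  have h : c • H + (c • H).conjTranspose = (2 * c.re) • H := by
    rw [Matrix.conjTranspose_smul, hH.eq, ← add_smul, Complex.star_def, Complex.add_conj,
      ← Complex.coe_smul]
  rw [h]
  exact L.smul_mem _ hL

/-- Matrix units have complex coefficients in the basis of Pauli strings, whereas the generators
form only a real space; passing to the complexification allows the expansion. -/
theorem complexification_hermitianGenerators_eq_top
    (hphase : ∀ z : ℂ, ‖z‖ = 1 → z • (1 : Operator n) ∈ G)
    (hlocal : ∀ (i : Fin n), ∀ B ∈ Matrix.unitaryGroup (Fin 2) ℂ, onQubit i B ∈ G)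
    (hcz : ∀ i j : Fin n, i ≠ j → onPair i j controlledZ ∈ G) :
    complexification (hermitianGenerators G hG) = ⊤ := by
  rw [eq_top_iff]
  intro M _
  rw [Matrix.matrix_eq_sum_single M]
  refine Submodule.sum_mem _ fun x _ => Submodule.sum_mem _ fun y _ => ?_
  have h : Matrix.single x y (M x y) =
      M x y • pureTensor fun l => Matrix.single (x l) (y l) (1 : ℂ) := by
    rw [pureTensor_single, Matrix.smul_single, smul_eq_mul, mul_one]
  rw [h]
  refine Submodule.smul_mem _ _ ?_
  choose r hr using fun l => eq_sum_pauli (Matrix.single (x l) (y l) (1 : ℂ))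
  simp only [hr]
  rw [pureTensor_sum_smul]
  refine Submodule.sum_mem _ fun κ _ => Submodule.smul_mem _ _ ?_
  refine mem_complexification_of_isHermitian ?_
    (pureTensor_pauli_mem_hermitianGenerators hphase hlocal hcz κ)
  rw [Matrix.IsHermitian, pureTensor_conjTranspose]
  simp only [(pauli_isHermitian _).eq]

/-- One-qubit gates, controlled-`Z` gates and phases generate a dense subgroup. -/
theorem mem_of_mem_unitaryGroup (hG : IsClosed (G : Set (Operator n)))
    (hphase : ∀ z : ℂ, ‖z‖ = 1 → z • (1 : Operator n) ∈ G)
    (hlocal : ∀ (i : Fin n), ∀ B ∈ Matrix.unitaryGroup (Fin 2) ℂ, onQubit i B ∈ G)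
    (hcz : ∀ i j : Fin n, i ≠ j → onPair i j controlledZ ∈ G) {U : Operator n}
    (hU : U ∈ Matrix.unitaryGroup (Fin n → Fin 2) ℂ) : U ∈ G := by
  obtain ⟨H, hH, rfl⟩ := exists_isHermitian_exp_eq hU
  have h : H ∈ complexification (hermitianGenerators G hG) := by
    rw [complexification_hermitianGenerators_eq_top hphase hlocal hcz]
    trivial
  -- Since H is Hermitian, H/2 plus its adjoint is H itself, so H lies in the real space.
  have h2 := h (1 / 2)
  rw [Matrix.conjTranspose_smul, hH.eq, ← add_smul] at h2
  have h3 : (1 / 2 + star (1 / 2) : ℂ) = 1 := by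
    rw [Complex.star_def, Complex.add_conj]; norm_num
  rw [h3, one_smul] at h2
  simpa using h2.2 1

end Density

/-! ## Universality under the pair encoding -/

/-- The operators implemented exactly on the pair encoding. -/
def implementable (S : Set TwoQubit) (n : ℕ) : Submonoid (Operator n) where
  carrier := {U | ∃ s, Implements S s U}
  one_mem' := ⟨0, Implements.one⟩
  mul_mem' := by
    rintro U V ⟨s, hs⟩ ⟨t, ht⟩
    exact ⟨s + t, hs.mul ht⟩

theorem isUniversalUnder_pairEncoding {S : Set TwoQubit} (hS : ∀ g, IsMatchgate g → g ∈ S)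
    {s t : ℕ} (hs : ImplementsPair S s controlledZ) (ht : ImplementsPair S t swapGate) :
    IsUniversalUnder S pairEncoding := by
  intro n U hU ε hε
  have hsub := Submonoid.le_topologicalClosure (implementable S n)
  have hmem : U ∈ (implementable S n).topologicalClosure := by
    refine mem_of_mem_unitaryGroup (Submonoid.isClosed_topologicalClosure _) ?_ ?_ ?_ hU
    · exact fun z hz => hsub ⟨0, Implements.one.smul hz⟩
    · exact fun i B hB => hsub ⟨1, implements_onQubit hS i hB⟩
    · exact fun i j hij => hsub ⟨_, implements_controlledZ hs ht hij⟩
  -- The tolerance absorbs the norm of the encoding; the added 1 keeps the denominator positive.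
  obtain ⟨V, ⟨m, hV⟩, hUV⟩ := Metric.mem_closure_iff.1 hmem
    (ε / (‖encoding pairEncoding n‖ + 1)) (by positivity)
  obtain ⟨m', -, C, z, hC, hz, h⟩ := hV
  refine ⟨m', C, z, hC, hz, ?_⟩
  rw [h, ← smul_sub, ← Matrix.mul_sub, norm_smul, hz, one_mul]
  rw [dist_comm, dist_eq_norm, lt_div_iff₀ (by positivity)] at hUV
  calc ‖encoding pairEncoding n * (V - U)‖ ≤ ‖encoding pairEncoding n‖ * ‖V - U‖ :=
        Matrix.l2_opNorm_mul _ _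
    _ ≤ ‖V - U‖ * (‖encoding pairEncoding n‖ + 1) := by
        rw [mul_comm]
        gcongr
        linarith
    _ < ε := hUV

end
end Matchgate

namespace Matchgate
noncomputable section

/-! ## Majorana operators -/

/-- The parity-changing gate that maps the odd subspace to the even one by `P`, and the even
subspace to the odd one by `Q`. -/
def oddGate (P Q : OneQubit) : TwoQubit := Matrix.of fun x y =>
  if x.1 = x.2 then
    if y.1 = y.2 then 0 else P x.1 y.1
  else
    if y.1 = y.2 then Q x.1 y.1 else 0

theorem parityGate_mul_oddGate (A B P Q : OneQubit) :
    parityGate A B * oddGate P Q = oddGate (A * P) (B * Q) := by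
  ext ⟨a, b⟩ ⟨c, d⟩
  fin_cases a <;> fin_cases b <;> fin_cases c <;> fin_cases d <;>
    simp [parityGate, oddGate, Matrix.mul_apply, Fintype.sum_prod_type]

theorem oddGate_mul_parityGate (A B P Q : OneQubit) :
    oddGate P Q * parityGate A B = oddGate (P * B) (Q * A) := by
  ext ⟨a, b⟩ ⟨c, d⟩
  fin_cases a <;> fin_cases b <;> fin_cases c <;> fin_cases d <;>
    simp [parityGate, oddGate, Matrix.mul_apply, Fintype.sum_prod_type]

theorem adjugate_eq_of_mem_unitaryGroup {A : OneQubit} (hA : A ∈ Matrix.unitaryGroup (Fin 2) ℂ) :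
    A.adjugate = A.det • A.conjTranspose := by
  have h1 : A.conjTranspose * A = 1 := Matrix.mem_unitaryGroup_iff'.1 hA
  calc A.adjugate = A.conjTranspose * (A * A.adjugate) := by rw [← mul_assoc, h1, one_mul]
    _ = A.det • A.conjTranspose := by rw [Matrix.mul_adjugate, mul_smul_comm, mul_one]

/-- Conjugation sends the odd blocks (P, Q) to (APB*, BQA*). As adj U = det U · U* for unitary U,
the relation Q = −adj P survives because det A = det B. These operators are the span of X⊗1, Y⊗1,
Z⊗X, Z⊗Y, the Majorana operators of two qubits, so this is where the determinant condition enters.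
-/
theorem IsMatchgate.conj_oddGate {g : TwoQubit} (hg : IsMatchgate g) (P : OneQubit) :
    ∃ P', g * oddGate P (-P.adjugate) * g.conjTranspose = oddGate P' (-P'.adjugate) := by
  obtain ⟨A, hA, B, hB, hdet, rfl⟩ := hg
  refine ⟨A * P * B.conjTranspose, ?_⟩
  have hB' : B.conjTranspose ∈ Matrix.unitaryGroup (Fin 2) ℂ := Unitary.star_mem hB
  have hBB : B * B.conjTranspose = 1 := Matrix.mem_unitaryGroup_iff.1 hB
  have h : B.conjTranspose.det * A.det = 1 := by
    rw [hdet, mul_comm, ← Matrix.det_mul, hBB, Matrix.det_one]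
  rw [parityGate_conjTranspose, parityGate_mul_oddGate, oddGate_mul_parityGate,
    Matrix.adjugate_mul_distrib, Matrix.adjugate_mul_distrib, adjugate_eq_of_mem_unitaryGroup hA,
    adjugate_eq_of_mem_unitaryGroup hB', Matrix.conjTranspose_conjTranspose, smul_mul_assoc,
    mul_smul_comm, mul_smul_comm, smul_smul, h, one_smul, mul_neg, neg_mul, mul_assoc B]

/-- Z ⊗ Z is the parity operator, which commutes with parity-preserving gates. -/
theorem IsMatchgate.conj_pauliZ_kronecker_pauliZ {g : TwoQubit} (hg : IsMatchgate g) :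
    g * (pauliZ ⊗ₖ pauliZ) * g.conjTranspose = pauliZ ⊗ₖ pauliZ := by
  have hgg := hg.mul_conjTranspose
  obtain ⟨A, hA, B, hB, hdet, rfl⟩ := hg
  have h : pauliZ ⊗ₖ pauliZ = parityGate 1 (-1) := by
    ext ⟨a, b⟩ ⟨c, d⟩
    fin_cases a <;> fin_cases b <;> fin_cases c <;> fin_cases d <;> simp [parityGate, pauliZ]
  have hc : parityGate A B * parityGate 1 (-1) = parityGate 1 (-1) * parityGate A B := by
    simp [parityGate_mul]
  rw [h, hc, mul_assoc, hgg, mul_one]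

theorem oddGate_pauliX : oddGate pauliX (-pauliX.adjugate) = pauliX ⊗ₖ 1 := by
  ext ⟨a, b⟩ ⟨c, d⟩
  fin_cases a <;> fin_cases b <;> fin_cases c <;> fin_cases d <;>
    simp [oddGate, pauliX, Matrix.adjugate_fin_two]

theorem oddGate_pauliY : oddGate pauliY (-pauliY.adjugate) = pauliY ⊗ₖ 1 := by
  ext ⟨a, b⟩ ⟨c, d⟩
  fin_cases a <;> fin_cases b <;> fin_cases c <;> fin_cases d <;>
    simp [oddGate, pauliY, Matrix.adjugate_fin_two]

theorem oddGate_pauliZ : oddGate pauliZ (-pauliZ.adjugate) = pauliZ ⊗ₖ pauliX := by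
  ext ⟨a, b⟩ ⟨c, d⟩
  fin_cases a <;> fin_cases b <;> fin_cases c <;> fin_cases d <;>
    simp [oddGate, pauliX, pauliZ, Matrix.adjugate_fin_two]

theorem oddGate_neg_I :
    oddGate (-Complex.I • 1) (-(-Complex.I • (1 : OneQubit)).adjugate) = pauliZ ⊗ₖ pauliY := by
  ext ⟨a, b⟩ ⟨c, d⟩
  fin_cases a <;> fin_cases b <;> fin_cases c <;> fin_cases d <;>
    simp [oddGate, pauliY, pauliZ, Matrix.adjugate_fin_two]

/-- The adjugate is linear on 2×2 matrices, so it suffices to expand `P` in the basis X, Y, Z, −i·1,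
whose images are the four operators on the right. -/
theorem exists_oddGate_eq (P : OneQubit) : ∃ a b c d : ℂ,
    oddGate P (-P.adjugate) = a • (pauliX ⊗ₖ 1) + b • (pauliY ⊗ₖ 1) + c • (pauliZ ⊗ₖ pauliX) +
      d • (pauliZ ⊗ₖ pauliY) := by
  have hI := Complex.I_mul_I
  refine ⟨(P 0 1 + P 1 0) / 2, Complex.I * (P 0 1 - P 1 0) / 2, (P 0 0 - P 1 1) / 2,
    Complex.I * (P 0 0 + P 1 1) / 2, ?_⟩
  rw [← oddGate_pauliX, ← oddGate_pauliY, ← oddGate_pauliZ, ← oddGate_neg_I]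
  ext ⟨a, b⟩ ⟨c, d⟩
  fin_cases a <;> fin_cases b <;> fin_cases c <;> fin_cases d <;>
    simp [oddGate, pauliX, pauliY, pauliZ, Matrix.adjugate_fin_two]
  · linear_combination (P 0 0 + P 1 1) / 2 * hI
  · linear_combination (P 0 1 - P 1 0) / 2 * hI
  · linear_combination -(P 1 1 + P 0 0) / 2 * hI
  · linear_combination (P 0 1 - P 1 0) / 2 * hI
  · linear_combination -(P 0 1 - P 1 0) / 2 * hI
  · linear_combination -(P 1 1 + P 0 0) / 2 * hI
  · linear_combination -(P 0 1 - P 1 0) / 2 * hI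
  · linear_combination (P 1 1 + P 0 0) / 2 * hI

variable {n : ℕ}

/-- The operator `P` on qubit `l`, with a Jordan–Wigner string of `Z`s before it. -/
def jordanWigner (l : Fin n) (P : OneQubit) : Operator n :=
  pureTensor fun m => if m < l then pauliZ else if m = l then P else 1

/-- The identity and the `2 n` Majorana operators. -/
def majorana : Option (Fin n × Fin 2) → Operator n
  | none => 1
  | some (l, a) => jordanWigner l (![pauliX, pauliY] a)

variable (n) in
/-- The span of the identity and of the Majorana operators. -/
def majoranaSpan : Submodule ℂ (Operator n) := Submodule.span ℂ (Set.range majorana)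

theorem one_mem_majoranaSpan : (1 : Operator n) ∈ majoranaSpan n :=
  Submodule.subset_span ⟨none, rfl⟩

theorem jordanWigner_pauliX_mem (l : Fin n) : jordanWigner l pauliX ∈ majoranaSpan n :=
  Submodule.subset_span ⟨some (l, 0), rfl⟩

theorem jordanWigner_pauliY_mem (l : Fin n) : jordanWigner l pauliY ∈ majoranaSpan n :=
  Submodule.subset_span ⟨some (l, 1), rfl⟩

/-- Counts products of d factors among 2n + 1 operators; as 1 is one of them, the d-th power of the
span contains all degrees up to d. -/
theorem finrank_majoranaSpan_pow_le (d : ℕ) :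
    Module.finrank ℂ ↥(majoranaSpan n ^ d) ≤ (n * 2 + 1) ^ d := by
  classical
  have h : (Set.range majorana : Set (Operator n)) = ↑(Finset.univ.image (majorana (n := n))) := by
    simp
  rw [majoranaSpan, Submodule.span_pow, h, ← Finset.coe_pow]
  refine (finrank_span_finset_le_card _).trans (Finset.card_pow_le.trans ?_)
  gcongr
  refine Finset.card_image_le.trans ?_
  simp

/-- The string of `Z`s on the qubits before `i`. -/
def zString (i : Fin n) : Fin n → OneQubit := fun m => if m < i then pauliZ else 1

theorem jordanWigner_left {i j : Fin n} (hij : (j : ℕ) = i + 1) (P : OneQubit) :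
    jordanWigner i P = pureTensor (zString i) * onPair i j (P ⊗ₖ 1) := by
  have hne : i ≠ j := by rintro rfl; omega
  rw [pureTensor_mul_onPair_kronecker hne, jordanWigner]
  congr 1
  funext m
  by_cases hj : m = j
  · subst hj
    have h1 : ¬ m < i := by rw [Fin.lt_def]; omega
    simp [zString, h1, hne.symm]
  · by_cases hi : m = i
    · subst hi; simp [zString, hne]
    · simp [zString, hi, hj]

theorem jordanWigner_right {i j : Fin n} (hij : (j : ℕ) = i + 1) (P : OneQubit) :
    jordanWigner j P = pureTensor (zString i) * onPair i j (pauliZ ⊗ₖ P) := by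
  have hne : i ≠ j := by rintro rfl; omega
  have hlt : i < j := by rw [Fin.lt_def]; omega
  rw [pureTensor_mul_onPair_kronecker hne, jordanWigner]
  congr 1
  funext m
  by_cases hj : m = j
  · subst hj
    have h1 : ¬ m < i := by rw [Fin.lt_def]; omega
    simp [zString, h1]
  · by_cases hi : m = i
    · subst hi; simp [zString, hne, hlt]
    · have h1 : m < j ↔ m < i := by
        rw [Fin.lt_def, Fin.lt_def]
        have := Fin.val_ne_of_ne hi
        omega
      simp [zString, hi, hj, h1]

theorem pureTensor_zString_mul_onPair_oddGate_mem {i j : Fin n} (hij : (j : ℕ) = i + 1)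
    (P : OneQubit) :
    pureTensor (zString i) * onPair i j (oddGate P (-P.adjugate)) ∈ majoranaSpan n := by
  obtain ⟨a, b, c, d, h⟩ := exists_oddGate_eq P
  rw [h, onPair_add, onPair_add, onPair_add, onPair_smul, onPair_smul, onPair_smul, onPair_smul,
    mul_add, mul_add, mul_add, mul_smul_comm, mul_smul_comm, mul_smul_comm, mul_smul_comm,
    ← jordanWigner_left hij, ← jordanWigner_left hij, ← jordanWigner_right hij,
    ← jordanWigner_right hij]
  exact add_mem (add_mem (add_mem (Submodule.smul_mem _ _ (jordanWigner_pauliX_mem _))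
    (Submodule.smul_mem _ _ (jordanWigner_pauliY_mem _)))
    (Submodule.smul_mem _ _ (jordanWigner_pauliX_mem _)))
    (Submodule.smul_mem _ _ (jordanWigner_pauliY_mem _))

/-! ### Conjugation of Majorana operators by matchgate circuits -/

theorem onPair_conj_mul {i j : Fin n} (h : i ≠ j) (g M : TwoQubit) {f : Fin n → OneQubit}
    (hi : f i = 1) (hj : f j = 1) :
    onPair i j g * (pureTensor f * onPair i j M) * (onPair i j g).conjTranspose =
      pureTensor f * onPair i j (g * M * g.conjTranspose) := by
  rw [← mul_assoc, onPair_commute_pureTensor h g hi hj, onPair_conjTranspose, mul_assoc, mul_assoc,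
    onPair_mul h, onPair_mul h, mul_assoc]

theorem onPair_conj_pureTensor {i j : Fin n} (h : i ≠ j) (g : TwoQubit) {f : Fin n → OneQubit}
    (hg : g * (f i ⊗ₖ f j) * g.conjTranspose = f i ⊗ₖ f j) :
    onPair i j g * pureTensor f * (onPair i j g).conjTranspose = pureTensor f := by
  have hf : pureTensor f = pureTensor (Function.update (Function.update f i 1) j 1) *
      onPair i j (f i ⊗ₖ f j) := by
    rw [pureTensor_mul_onPair_kronecker h]
    congr 1
    funext l
    by_cases hj : l = j
    · subst hj; simp
    · by_cases hi : l = i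
      · subst hi; simp [h]
      · simp [hi, hj]
  rw [hf, onPair_conj_mul h _ _ (by simp [h]) (by simp), hg]

/-- For l < i the operator is trivial on the pair; for l = i or l = j it is the common string of Z's
times an odd gate, to which `IsMatchgate.conj_oddGate` applies; for l > j it acts on the pair as the
parity Z ⊗ Z. Adjacency of i and j ensures that there are no other cases. -/
theorem onPair_conj_jordanWigner_mem {g : TwoQubit} (hg : IsMatchgate g) {i j : Fin n}
    (hij : (j : ℕ) = i + 1) (l : Fin n) {P : OneQubit} (hP : jordanWigner l P ∈ majoranaSpan n)
    (hleft : ∃ P', P ⊗ₖ 1 = oddGate P' (-P'.adjugate))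
    (hright : ∃ P', pauliZ ⊗ₖ P = oddGate P' (-P'.adjugate)) :
    onPair i j g * jordanWigner l P * (onPair i j g).conjTranspose ∈ majoranaSpan n := by
  have hne : i ≠ j := by rintro rfl; omega
  have hi1 : zString i i = 1 := by simp [zString]
  have hj1 : zString i j = 1 := by
    have h1 : ¬ j < i := by rw [Fin.lt_def]; omega
    simp [zString, h1]
  have hmid : ∀ P, onPair i j g * (pureTensor (zString i) *
      onPair i j (oddGate P (-P.adjugate))) * (onPair i j g).conjTranspose ∈ majoranaSpan n := by
    intro P
    obtain ⟨P', hP'⟩ := hg.conj_oddGate P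
    rw [onPair_conj_mul hne _ _ hi1 hj1, hP']
    exact pureTensor_zString_mul_onPair_oddGate_mem hij P'
  rcases lt_trichotomy l i with h | rfl | h
  · have h1 : l < j := h.trans (by rw [Fin.lt_def]; omega)
    rw [jordanWigner, onPair_conj_pureTensor hne]
    · exact hP
    · simp [h.ne', h1.ne', h.not_gt, h1.not_gt, hg.mul_conjTranspose]
  · obtain ⟨P', hP'⟩ := hleft
    rw [jordanWigner_left hij, hP']
    exact hmid P'
  · by_cases hlj : l = j
    · subst hlj
      obtain ⟨P', hP'⟩ := hright
      rw [jordanWigner_right hij, hP']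
      exact hmid P'
    · have h1 : j < l := by
        rw [Fin.lt_def] at h ⊢
        have := Fin.val_ne_of_ne hlj
        omega
      rw [jordanWigner, onPair_conj_pureTensor hne]
      · exact hP
      · simp [h, h1, hg.conj_pauliZ_kronecker_pauliZ]

theorem onPair_conj_mem_majoranaSpan {g : TwoQubit} (hg : IsMatchgate g) {i j : Fin n}
    (hij : (j : ℕ) = i + 1) {M : Operator n} (hM : M ∈ majoranaSpan n) :
    onPair i j g * M * (onPair i j g).conjTranspose ∈ majoranaSpan n := by
  have hne : i ≠ j := by rintro rfl; omega
  induction hM using Submodule.span_induction with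
  | mem M hM =>
    obtain ⟨(_ | ⟨l, a⟩), rfl⟩ := hM
    · rw [majorana, mul_one, onPair_conjTranspose, onPair_mul hne, hg.mul_conjTranspose, onPair_one]
      exact one_mem_majoranaSpan
    · rw [majorana]
      fin_cases a
      · exact onPair_conj_jordanWigner_mem hg hij l (jordanWigner_pauliX_mem l)
          ⟨_, oddGate_pauliX.symm⟩ ⟨_, oddGate_pauliZ.symm⟩
      · exact onPair_conj_jordanWigner_mem hg hij l (jordanWigner_pauliY_mem l)
          ⟨_, oddGate_pauliY.symm⟩ ⟨_, oddGate_neg_I.symm⟩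
  | zero => rw [mul_zero, zero_mul]; exact zero_mem _
  | add M N _ _ hM hN => rw [mul_add, add_mul]; exact add_mem hM hN
  | smul r M _ hM => rw [mul_smul_comm, smul_mul_assoc]; exact Submodule.smul_mem _ _ hM

theorem conj_mem_submodule_pow {A : Type*} [Ring A] [Algebra ℂ A] {V : Submodule ℂ A} {u w : A}
    (huw : u * w = 1) (hwu : w * u = 1) (h : ∀ M ∈ V, u * M * w ∈ V) (d : ℕ) {M : A}
    (hM : M ∈ V ^ d) : u * M * w ∈ V ^ d := by
  induction d generalizing M with
  | zero =>
    rw [pow_zero, Submodule.mem_one] at hM ⊢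
    obtain ⟨r, rfl⟩ := hM
    exact ⟨r, by rw [← Algebra.commutes, mul_assoc, huw, mul_one]⟩
  | succ d ih =>
    rw [pow_succ] at hM ⊢
    induction hM using Submodule.mul_induction_on' with
    | mem_mul_mem a ha b hb =>
      have h2 : u * (a * b) * w = (u * a * w) * (u * b * w) := by
        calc u * (a * b) * w = u * a * 1 * b * w := by simp only [mul_assoc, one_mul]
          _ = (u * a * w) * (u * b * w) := by rw [← hwu]; simp only [mul_assoc]
      rw [h2]
      exact Submodule.mul_mem_mul (ih ha) (h b hb)
    | add a _ b _ ha hb => rw [mul_add, add_mul]; exact add_mem ha hb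

/-- Conjugation by a matchgate circuit does not increase the degree in the Majorana operators. -/
theorem IsCircuit.conj_mem_majoranaSpan_pow {S : Set TwoQubit} (hS : ∀ g ∈ S, IsMatchgate g)
    {s : ℕ} {C : Operator n} (hC : IsCircuit (neighbourGates S n) s C) (d : ℕ) {M : Operator n}
    (hM : M ∈ majoranaSpan n ^ d) : C.conjTranspose * M * C ∈ majoranaSpan n ^ d := by
  obtain ⟨L, -, hL, rfl⟩ := hC
  clear s
  induction L generalizing M with
  | nil => simpa using hM
  | cons A L ih =>
    rw [List.prod_cons, Matrix.conjTranspose_mul]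
    have hA : A.conjTranspose * M * A ∈ majoranaSpan n ^ d := by
      obtain ⟨i, j, hij, g, hg, rfl⟩ := hL A (by simp)
      have hne : i ≠ j := by rintro rfl; omega
      have hgm := hS g hg
      have h1 : g.conjTranspose * g = 1 := by
        simpa using hgm.conjTranspose.mul_conjTranspose
      refine conj_mem_submodule_pow ?_ ?_ (fun N hN => ?_) d hM
      · rw [onPair_conjTranspose, onPair_mul hne, h1, onPair_one]
      · rw [onPair_conjTranspose, onPair_mul hne, hgm.mul_conjTranspose, onPair_one]
      · have h2 := onPair_conj_mem_majoranaSpan hgm.conjTranspose hij hN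
        rwa [← onPair_conjTranspose, Matrix.conjTranspose_conjTranspose] at h2
    have h := ih hA fun B hB => hL B (by simp [hB])
    simpa only [mul_assoc] using h

/-- XY = iZ, and the two Jordan–Wigner strings cancel. -/
theorem onQubit_pauliZ_eq (l : Fin n) :
    onQubit l pauliZ = -Complex.I • (jordanWigner l pauliX * jordanWigner l pauliY) := by
  have h : pauliX * pauliY = Complex.I • pauliZ := by
    ext a b; fin_cases a <;> fin_cases b <;> simp [pauliX, pauliY, pauliZ]
  rw [jordanWigner, jordanWigner, pureTensor_mul]
  have h2 : (fun m => (if m < l then pauliZ else if m = l then pauliX else 1) *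
      (if m < l then pauliZ else if m = l then pauliY else 1)) =
      Function.update (fun _ => 1) l (Complex.I • pauliZ) := by
    funext m
    rcases lt_trichotomy m l with hm | rfl | hm
    · simp [hm, hm.ne, pauliZ_mul_self]
    · simp [h]
    · simp [hm.not_gt, hm.ne']
  rw [h2, pureTensor_update_smul, smul_smul, ← onQubit_eq_pureTensor]
  simp

/-- Every operator on the first `m` qubits has degree at most `2 m` in the Majorana operators. -/
theorem pureTensor_mem_majoranaSpan_pow (m : ℕ) {f : Fin n → OneQubit}
    (hf : ∀ l : Fin n, m ≤ l → f l = 1) : pureTensor f ∈ majoranaSpan n ^ (2 * m) := by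
  induction m generalizing f with
  | zero =>
    have h : f = fun _ => 1 := funext fun l => hf l (Nat.zero_le _)
    rw [h, pureTensor_one, mul_zero, pow_zero]
    exact Submodule.one_le.1 le_rfl
  | succ m ih =>
    have hmul : ∀ {M N K : Operator n}, M ∈ majoranaSpan n ^ (2 * m) → N ∈ majoranaSpan n →
        K ∈ majoranaSpan n → M * (N * K) ∈ majoranaSpan n ^ (2 * (m + 1)) := by
      intro M N K hM hN hK
      rw [mul_add, mul_one, pow_add, pow_two]
      exact Submodule.mul_mem_mul hM (Submodule.mul_mem_mul hN hK)
    by_cases hm : m < n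
    · obtain ⟨s, hs⟩ : ∃ s : Fin n, (s : ℕ) = m := ⟨⟨m, hm⟩, rfl⟩
      have hf1 : ∀ l : Fin n, m ≤ l → Function.update f s 1 l = 1 := by
        intro l hl
        by_cases h : l = s
        · subst h; simp
        · rw [Function.update_of_ne h]
          have := Fin.val_ne_of_ne h
          exact hf l (by omega)
      have hI := ih hf1
      -- The extra Z's on the earlier qubits cancel the Jordan–Wigner string of the operator on `s`,
      -- without changing the support.
      have hZf : ∀ P, pureTensor (Function.update f s P) =
          pureTensor (fun l => if l < s then f l * pauliZ else 1) * (jordanWigner s P * 1) := by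
        intro P
        rw [mul_one, jordanWigner, pureTensor_mul]
        congr 1
        funext l
        rcases lt_trichotomy l s with h | rfl | h
        · simp [h, h.ne, mul_assoc, pauliZ_mul_self]
        · simp
        · simpa [h.not_gt, h.ne'] using hf l (by rw [Fin.lt_def] at h; omega)
      have hZ := ih (f := fun l => if l < s then f l * pauliZ else 1) (by
        intro l hl
        have : ¬ l < s := by rw [Fin.lt_def]; omega
        simp [this])
      have hpauli : ∀ a, pureTensor (Function.update f s (pauli a)) ∈
          majoranaSpan n ^ (2 * (m + 1)) := by
        intro a
        fin_cases a
        · have h := hmul hI one_mem_majoranaSpan one_mem_majoranaSpan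
          rwa [mul_one, mul_one] at h
        · change pureTensor (Function.update f s pauliX) ∈ _
          rw [hZf]
          exact hmul hZ (jordanWigner_pauliX_mem s) one_mem_majoranaSpan
        · change pureTensor (Function.update f s pauliY) ∈ _
          rw [hZf]
          exact hmul hZ (jordanWigner_pauliY_mem s) one_mem_majoranaSpan
        -- A Z needs two Majorana operators, hence two degrees per qubit; the other cases are padded
        -- with 1.
        · change pureTensor (Function.update f s pauliZ) ∈ _
          have h : pureTensor (Function.update f s pauliZ) =
              pureTensor (Function.update f s 1) * onQubit s pauliZ := by
            rw [pureTensor_mul_onQubit]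
            simp
          rw [h, onQubit_pauliZ_eq, mul_smul_comm]
          exact Submodule.smul_mem _ _
            (hmul hI (jordanWigner_pauliX_mem s) (jordanWigner_pauliY_mem s))
      obtain ⟨r, hr⟩ := eq_sum_pauli (f s)
      rw [← Function.update_eq_self s f, hr, Fin.sum_univ_four]
      simp only [pureTensor_update_add, pureTensor_update_smul]
      exact add_mem (add_mem (add_mem (Submodule.smul_mem _ _ (hpauli 0))
        (Submodule.smul_mem _ _ (hpauli 1))) (Submodule.smul_mem _ _ (hpauli 2)))
        (Submodule.smul_mem _ _ (hpauli 3))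
    · have h := hmul (ih (f := f) fun l hl => absurd l.2 (by omega)) one_mem_majoranaSpan
        one_mem_majoranaSpan
      rwa [mul_one, mul_one] at h

end
end Matchgate

namespace Matchgate
noncomputable section

/-! ## Spaces of matrices that are invariant under conjugation by unitary matrices -/

section Invariant
variable {ι : Type*} [Fintype ι] [DecidableEq ι] {W : Submodule ℂ (Matrix ι ι ℂ)}

/-- U = 1 + (i − 1)P, which is i on the range of P and 1 on its complement, is unitary. In UMU* −
U*MU the terms PMP cancel and 2i(PM − MP) remains, so no limit or derivative is needed. -/
theorem commutator_projection_mem (hW : ∀ U ∈ Matrix.unitaryGroup ι ℂ, ∀ M ∈ W,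
    U.conjTranspose * M * U ∈ W) {P M : Matrix ι ι ℂ} (hP : P.IsHermitian) (hP2 : P * P = P)
    (hM : M ∈ W) : P * M - M * P ∈ W := by
  set q : ℂ := Complex.I - 1 with hq
  have hq' : star q = -Complex.I - 1 := by simp [hq]
  have hI := Complex.I_mul_I
  set U : Matrix ι ι ℂ := 1 + q • P with hU
  have hUs : U.conjTranspose = 1 + star q • P := by
    rw [hU, Matrix.conjTranspose_add, Matrix.conjTranspose_one, Matrix.conjTranspose_smul, hP.eq]
  have hUU : U * U.conjTranspose = 1 := by
    have h : q + (star q + q * star q) = 0 := by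
      rw [hq', hq]
      linear_combination -hI
    calc U * U.conjTranspose = 1 + q • P + (star q • P + (q * star q) • (P * P)) := by
          rw [hUs, hU, mul_add, mul_one, add_mul, one_mul, smul_mul_smul_comm]
      _ = 1 + (q + (star q + q * star q)) • P := by rw [hP2, add_smul, add_smul, add_assoc]
      _ = 1 := by rw [h, zero_smul, add_zero]
  have hmem : U ∈ Matrix.unitaryGroup ι ℂ := Matrix.mem_unitaryGroup_iff.2 hUU
  have h1 := hW U hmem M hM
  have h2 := hW _ (Unitary.star_mem hmem) M hM
  rw [Matrix.star_eq_conjTranspose, Matrix.conjTranspose_conjTranspose] at h2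
  have h3 : U * M * U.conjTranspose - U.conjTranspose * M * U =
      (2 * Complex.I) • (P * M - M * P) := by
    have h4 : (2 * Complex.I) = q - star q := by rw [hq', hq]; ring
    rw [hUs, hU, h4]
    simp only [add_mul, mul_add, one_mul, mul_one, smul_mul_assoc, mul_smul_comm, sub_smul,
      smul_sub, smul_add, smul_smul, mul_comm (star q) q]
    abel
  have h5 : P * M - M * P = (2 * Complex.I)⁻¹ •
      (U * M * U.conjTranspose - U.conjTranspose * M * U) := by
    rw [h3, smul_smul, inv_mul_cancel₀ (by simp), one_smul]
  rw [h5]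
  exact W.smul_mem _ (W.sub_mem h2 h1)

theorem single_projection (x : ι) : (Matrix.single x x (1 : ℂ)).IsHermitian ∧
    Matrix.single x x (1 : ℂ) * Matrix.single x x 1 = Matrix.single x x 1 := by
  constructor
  · rw [Matrix.IsHermitian, Matrix.conjTranspose_single, star_one]
  · rw [Matrix.single_mul_single_same, one_mul]

/-- This is the projection onto the line of e_x + ω̄ e_y; ω = 1 and ω = i serve to isolate an
off-diagonal matrix unit. -/
theorem plane_projection {x y : ι} (hxy : x ≠ y) {ω : ℂ} (hω : ω * star ω = 1) :
    ((2⁻¹ : ℂ) • (Matrix.single x x 1 + Matrix.single y y 1 + Matrix.single x y ω +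
      Matrix.single y x (star ω))).IsHermitian ∧
    ((2⁻¹ : ℂ) • (Matrix.single x x 1 + Matrix.single y y 1 + Matrix.single x y ω +
      Matrix.single y x (star ω))) * ((2⁻¹ : ℂ) • (Matrix.single x x 1 + Matrix.single y y 1 +
        Matrix.single x y ω + Matrix.single y x (star ω))) =
      (2⁻¹ : ℂ) • (Matrix.single x x 1 + Matrix.single y y 1 + Matrix.single x y ω +
        Matrix.single y x (star ω)) := by
  have hω' : star ω * ω = 1 := by rw [mul_comm, hω]
  constructor
  · rw [Matrix.IsHermitian, Matrix.conjTranspose_smul]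
    simp only [Matrix.conjTranspose_add, Matrix.conjTranspose_single, star_one, star_star]
    have h2 : star (2⁻¹ : ℂ) = 2⁻¹ := by simp
    rw [h2, add_right_comm (Matrix.single x x 1 + Matrix.single y y 1)]
  · have h : (Matrix.single x x 1 + Matrix.single y y 1 + Matrix.single x y ω +
        Matrix.single y x (star ω)) * (Matrix.single x x 1 + Matrix.single y y 1 +
        Matrix.single x y ω + Matrix.single y x (star ω)) =
        (2 : ℂ) • (Matrix.single x x 1 + Matrix.single y y 1 + Matrix.single x y ω +
        Matrix.single y x (star ω)) := by
      simp only [mul_add, add_mul, Matrix.single_mul_single_same, ne_eq, hxy, hxy.symm,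
        not_false_eq_true, Matrix.single_mul_single_of_ne, hω, hω', one_mul, mul_one, add_zero,
        zero_add, two_smul]
      abel
    rw [smul_mul_smul_comm, h, smul_smul]
    norm_num

theorem commutator_single_mem (hW : ∀ U ∈ Matrix.unitaryGroup ι ℂ, ∀ M ∈ W,
    U.conjTranspose * M * U ∈ W) (x y : ι) {M : Matrix ι ι ℂ} (hM : M ∈ W) :
    Matrix.single x y 1 * M - M * Matrix.single x y 1 ∈ W := by
  let K : Submodule ℂ (Matrix ι ι ℂ) :=
    { carrier := {A | A * M - M * A ∈ W}
      zero_mem' := by simp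
      add_mem' := fun {A B} hA hB => by
        have h : (A + B) * M - M * (A + B) = (A * M - M * A) + (B * M - M * B) := by
          rw [add_mul, mul_add]; abel
        simp only [Set.mem_ofPred_eq, h]
        exact W.add_mem hA hB
      smul_mem' := fun r A hA => by
        simp only [Set.mem_ofPred_eq, smul_mul_assoc, mul_smul_comm, ← smul_sub]
        exact W.smul_mem r hA }
  have hproj : ∀ P : Matrix ι ι ℂ, P.IsHermitian ∧ P * P = P → P ∈ K := fun P hP =>
    commutator_projection_mem hW hP.1 hP.2 hM
  change _ ∈ K
  by_cases hxy : x = y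
  · subst hxy
    exact hproj _ (single_projection x)
  · have hx := hproj _ (single_projection x)
    have hy := hproj _ (single_projection y)
    have h1 := K.smul_mem 2 (hproj _ (plane_projection hxy (ω := 1) (by simp)))
    have h2 := K.smul_mem 2 (hproj _ (plane_projection hxy (ω := Complex.I) (by simp)))
    rw [smul_smul, mul_inv_cancel₀ two_ne_zero, one_smul] at h1 h2
    have h3 := K.sub_mem (K.sub_mem h1 hx) hy
    have h4 := K.sub_mem (K.sub_mem h2 hx) hy
    -- Polarization: E_xy is half of (E_xy + E_yx) − i(iE_xy − iE_yx).
    have h5 : Matrix.single x y (1 : ℂ) = (2⁻¹ : ℂ) •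
        ((Matrix.single x x 1 + Matrix.single y y 1 + Matrix.single x y 1 +
          Matrix.single y x (star 1) - Matrix.single x x 1 - Matrix.single y y 1) - Complex.I •
        (Matrix.single x x 1 + Matrix.single y y 1 + Matrix.single x y Complex.I +
          Matrix.single y x (star Complex.I) - Matrix.single x x 1 - Matrix.single y y 1)) := by
      have h6 : ∀ z w : ℂ, Matrix.single x x (1 : ℂ) + Matrix.single y y 1 + Matrix.single x y z +
          Matrix.single y x w - Matrix.single x x 1 - Matrix.single y y 1 =
          Matrix.single x y z + Matrix.single y x w := fun z w => by abel
      have h7 : ∀ (a b : ι) (z : ℂ), Matrix.single a b z = z • Matrix.single a b (1 : ℂ) :=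
        fun a b z => by rw [Matrix.smul_single, smul_eq_mul, mul_one]
      rw [h6, h6, h7 x y Complex.I, h7 y x (star 1), h7 y x (star Complex.I), smul_add, smul_smul,
        smul_smul, Complex.star_def, Complex.conj_I, mul_neg, Complex.I_mul_I, map_one]
      module
    rw [h5]
    exact K.smul_mem _ (K.sub_mem h3 (K.smul_mem _ h4))

/-- A space of matrices that is invariant under conjugation by unitary matrices and contains a
diagonal matrix that is not scalar has a large dimension. -/
theorem card_le_finrank_add_one (hW : ∀ U ∈ Matrix.unitaryGroup ι ℂ, ∀ M ∈ W,
    U.conjTranspose * M * U ∈ W) {d : ι → ℂ} (hd : Matrix.diagonal d ∈ W) {x y : ι}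
    (hxy : d x ≠ d y) : Fintype.card ι ≤ Module.finrank ℂ W + 1 := by
  have hne : x ≠ y := by rintro rfl; exact hxy rfl
  -- The commutator of E_xy with the diagonal matrix is (d_y − d_x)E_xy, a nonzero multiple.
  have h1 : Matrix.single x y (1 : ℂ) ∈ W := by
    have h := commutator_single_mem hW x y hd
    have h2 : Matrix.single x y (1 : ℂ) * Matrix.diagonal d -
        Matrix.diagonal d * Matrix.single x y 1 = (d y - d x) • Matrix.single x y 1 := by
      rw [sub_smul, Matrix.smul_single, Matrix.smul_single]
      ext a b
      simp only [Matrix.sub_apply, Matrix.mul_diagonal, Matrix.diagonal_mul, Matrix.single_apply]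
      split_ifs with h
      · simp [h.1, h.2]
      · simp
    rw [h2] at h
    have h3 := W.smul_mem (d y - d x)⁻¹ h
    rwa [smul_smul, inv_mul_cancel₀ (sub_ne_zero.2 (Ne.symm hxy)), one_smul] at h3
  -- [E_zx, E_xy] = E_zy for z ≠ y: one column of matrix units, except its diagonal entry, already
  -- suffices for the bound.
  have h2 : ∀ z : {z // z ≠ y}, Matrix.single z.1 y (1 : ℂ) ∈ W := by
    intro z
    have h := commutator_single_mem hW z.1 x h1
    rwa [Matrix.single_mul_single_same, one_mul, Matrix.single_mul_single_of_ne _ _ _ _ z.2.symm,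
      sub_zero] at h
  have hli : LinearIndependent ℂ fun z : {z // z ≠ y} => (⟨_, h2 z⟩ : W) := by
    refine LinearIndependent.of_comp W.subtype ?_
    have h3 := (Matrix.stdBasis ℂ ι ι).linearIndependent.comp
      (fun z : {z // z ≠ y} => (z.1, y)) fun a b hab => Subtype.ext (Prod.ext_iff.1 hab).1
    convert h3 using 1
    funext z
    simp [Matrix.stdBasis_eq_single]
  have h4 := hli.fintype_card_le_finrank
  rw [Fintype.card_subtype_compl, Fintype.card_subtype_eq] at h4
  omega

end Invariant

/-! ## Operators on one block -/

variable {n k : ℕ}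

/-- Split the qubits into blocks. -/
def blocks (x : Fin (n * k) → Fin 2) : Fin n → Fin k → Fin 2 := fun i r => x (blockQubit i r)

theorem blocks_bijective : Function.Bijective (blocks (n := n) (k := k)) := by
  refine ⟨fun x y h => funext fun p => ?_, fun z => ⟨fun p => z (finProdFinEquiv.symm p).1
    (finProdFinEquiv.symm p).2, ?_⟩⟩
  · obtain ⟨⟨i, r⟩, rfl⟩ := finProdFinEquiv.surjective p
    exact congrFun (congrFun h i) r
  · funext i r
    simp [blocks, blockQubit]

/-- The operator `O` on the block `i`. -/
def onBlock (i : Fin n) (O : Matrix (Fin k → Fin 2) (Fin k → Fin 2) ℂ) : Operator (n * k) :=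
  (pureTensor (Function.update (fun _ : Fin n =>
    (1 : Matrix (Fin k → Fin 2) (Fin k → Fin 2) ℂ)) i O)).submatrix blocks blocks

theorem encoding_eq_submatrix (v : Matrix (Fin k → Fin 2) (Fin 2) ℂ) :
    encoding v n = (pureTensor fun _ : Fin n => v).submatrix blocks id := rfl

theorem encoding_conjTranspose_mul_onBlock_mul {v : Matrix (Fin k → Fin 2) (Fin 2) ℂ}
    (hv : v.conjTranspose * v = 1) (i : Fin n) (O : Matrix (Fin k → Fin 2) (Fin k → Fin 2) ℂ) :
    (encoding v n).conjTranspose * onBlock i O * encoding v n =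
      onQubit i (v.conjTranspose * O * v) := by
  rw [encoding_eq_submatrix, Matrix.conjTranspose_submatrix, onBlock,
    ← Matrix.submatrix_mul _ _ _ _ _ blocks_bijective,
    ← Matrix.submatrix_mul _ _ _ _ _ blocks_bijective, pureTensor_conjTranspose, pureTensor_mul,
    pureTensor_mul, onQubit_eq_pureTensor, Matrix.submatrix_id_id]
  congr 1
  funext l
  by_cases h : l = i
  · subst h; simp
  · simp [h, hv]

theorem pureTensor_blocks (f : Fin n → Fin k → OneQubit) :
    (pureTensor fun i => pureTensor (f i)).submatrix blocks blocks =
      pureTensor fun p : Fin (n * k) => f (finProdFinEquiv.symm p).1 (finProdFinEquiv.symm p).2 := by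
  ext x y
  rw [Matrix.submatrix_apply, pureTensor_apply, pureTensor_apply,
    ← finProdFinEquiv.prod_comp, Fintype.prod_prod_type]
  refine Finset.prod_congr rfl fun i _ => ?_
  rw [pureTensor_apply]
  refine Finset.prod_congr rfl fun r _ => ?_
  rw [Equiv.symm_apply_apply]
  rfl

/-- `onBlock i` as a linear map. -/
def onBlockHom (i : Fin n) :
    Matrix (Fin k → Fin 2) (Fin k → Fin 2) ℂ →ₗ[ℂ] Operator (n * k) where
  toFun := onBlock i
  map_add' O O' := by
    rw [onBlock, pureTensor_update_add]; rfl
  map_smul' r O := by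
    rw [onBlock, pureTensor_update_smul]; rfl

/-- The first block occupies the first k qubits, where the Jordan–Wigner strings stay inside the
block; the degree 2k is therefore independent of the number of blocks. -/
theorem onBlock_zero_mem_majoranaSpan_pow (O : Matrix (Fin k → Fin 2) (Fin k → Fin 2) ℂ) :
    onBlock (0 : Fin (n + 1)) O ∈ majoranaSpan ((n + 1) * k) ^ (2 * k) := by
  change onBlockHom 0 O ∈ _
  rw [Matrix.matrix_eq_sum_single O]
  simp only [map_sum]
  refine Submodule.sum_mem _ fun a _ => Submodule.sum_mem _ fun b _ => ?_
  have h : Matrix.single a b (O a b) = O a b • Matrix.single a b (1 : ℂ) := by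
    rw [Matrix.smul_single, smul_eq_mul, mul_one]
  rw [h, map_smul]
  refine Submodule.smul_mem _ _ ?_
  have h2 : onBlockHom (0 : Fin (n + 1)) (Matrix.single a b (1 : ℂ)) =
      pureTensor fun p : Fin ((n + 1) * k) => if (finProdFinEquiv.symm p).1 = 0 then
        Matrix.single (a (finProdFinEquiv.symm p).2) (b (finProdFinEquiv.symm p).2) (1 : ℂ)
        else 1 := by
    rw [← pureTensor_blocks fun i r => if i = 0 then Matrix.single (a r) (b r) (1 : ℂ) else 1]
    change onBlock _ _ = _
    rw [onBlock]
    congr 2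
    funext i
    by_cases hi : i = 0
    · subst hi; simp [pureTensor_single]
    · simp [hi, pureTensor_one]
  rw [h2]
  refine pureTensor_mem_majoranaSpan_pow k fun p hp => if_neg ?_
  obtain ⟨⟨i, r⟩, rfl⟩ := finProdFinEquiv.surjective p
  rw [Equiv.symm_apply_apply]
  rintro rfl
  have := r.2
  simp only [finProdFinEquiv_apply_val, Fin.val_zero, mul_zero, add_zero] at hp
  omega

/-! ## Matchgates are not universal -/

open Filter Topology in
theorem exists_pow_lt_two_pow (k : ℕ) : ∃ n : ℕ, ((n + 1) * k * 2 + 1) ^ (2 * k) + 1 < 2 ^ (n + 1) := by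
  -- The base is at most (n+1)(2k+1), which splits off the power of n + 1; the factor 2 absorbs the
  -- summand 1.
  set c : ℕ := 2 * (2 * k + 1) ^ (2 * k) with hc
  have hcpos : 0 < c := by positivity
  have h := tendsto_pow_const_div_const_pow_of_one_lt (2 * k) (r := (2 : ℝ)) (by norm_num)
  have h2 := (h.eventually_lt_const (show (0 : ℝ) < 1 / c by positivity)).and
    (eventually_ge_atTop 1)
  obtain ⟨m, hm, hm1⟩ := h2.exists
  obtain ⟨n, rfl⟩ : ∃ n, m = n + 1 := ⟨m - 1, by omega⟩
  refine ⟨n, ?_⟩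
  rw [div_lt_div_iff₀ (by positivity) (by positivity), one_mul] at hm
  have hm' : (n + 1) ^ (2 * k) * c < 2 ^ (n + 1) := by exact_mod_cast hm
  refine lt_of_le_of_lt ?_ hm'
  have h3 : (n + 1) * k * 2 + 1 ≤ (n + 1) * (2 * k + 1) := by nlinarith
  have h4 : 1 ≤ ((n + 1) * (2 * k + 1)) ^ (2 * k) := Nat.one_le_pow _ _ (by positivity)
  calc ((n + 1) * k * 2 + 1) ^ (2 * k) + 1
      ≤ ((n + 1) * (2 * k + 1)) ^ (2 * k) + ((n + 1) * (2 * k + 1)) ^ (2 * k) := by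
        gcongr
    _ = (n + 1) ^ (2 * k) * c := by rw [hc, mul_pow]; ring

/-- The compression to the code space. -/
def compression (v : Matrix (Fin k → Fin 2) (Fin 2) ℂ) (n : ℕ) :
    Operator (n * k) →ₗ[ℂ] Operator n where
  toFun (Q : Operator (n * k)) := (encoding v n).conjTranspose * Q * encoding v n
  map_add' (Q R : Operator (n * k)) := by rw [Matrix.mul_add, Matrix.add_mul]
  map_smul' r (Q : Operator (n * k)) := by rw [Matrix.mul_smul, Matrix.smul_mul, RingHom.id_apply]

/-- The compressions to the code space of the operators of degree at most `d` in the Majorana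
operators. -/
def compressedSpan (v : Matrix (Fin k → Fin 2) (Fin 2) ℂ) (n d : ℕ) : Submodule ℂ (Operator n) :=
  (majoranaSpan (n * k) ^ d).map (compression v n)

theorem mem_compressedSpan {v : Matrix (Fin k → Fin 2) (Fin 2) ℂ} {d : ℕ} {Q : Operator (n * k)}
    (hQ : Q ∈ majoranaSpan (n * k) ^ d) :
    (encoding v n).conjTranspose * Q * encoding v n ∈ compressedSpan v n d :=
  Submodule.mem_map.2 ⟨Q, hQ, rfl⟩

open Filter Topology in
-- Let E be the encoding and let circuits C_m approximate `U`, so that C_m E tends to EU up to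
-- phases, which cancel in a conjugation. Then U*(E*QE)U is the limit of E*(C_m* Q C_m)E. These lie
-- in the compressed space, which is closed as it is finite-dimensional.
theorem conj_mem_compressedSpan {S : Set TwoQubit} (hS : ∀ g ∈ S, IsMatchgate g)
    {v : Matrix (Fin k → Fin 2) (Fin 2) ℂ} (hu : IsUniversalUnder S v) (d : ℕ) {U M : Operator n}
    (hU : U ∈ Matrix.unitaryGroup (Fin n → Fin 2) ℂ) (hM : M ∈ compressedSpan v n d) :
    U.conjTranspose * M * U ∈ compressedSpan v n d := by
  obtain ⟨Q, hQ, rfl⟩ := Submodule.mem_map.1 hM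
  choose s C z hC hz hlt using fun m : ℕ => hu n U hU (1 / ((m : ℝ) + 1)) (by positivity)
  have hzz : ∀ m, star (z m) * z m = 1 := fun m => by
    rw [Complex.star_def, ← Complex.normSq_eq_conj_mul_self, Complex.normSq_eq_norm_sq, hz m]
    simp
  have hlim : Tendsto (fun m => star (z m) • (C m * encoding v n)) atTop
      (𝓝 (encoding v n * U)) := by
    rw [tendsto_iff_norm_sub_tendsto_zero]
    refine squeeze_zero (fun m => norm_nonneg _) (fun m => ?_)
      tendsto_one_div_add_atTop_nhds_zero_nat
    have h : star (z m) • (C m * encoding v n) - encoding v n * U =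
        star (z m) • (C m * encoding v n - z m • (encoding v n * U)) := by
      rw [smul_sub, smul_smul, hzz, one_smul]
    rw [h, norm_smul, norm_star, hz m, one_mul]
    exact (hlt m).le
  have hcont : Continuous fun D : Matrix (Fin (n * k) → Fin 2) (Fin n → Fin 2) ℂ =>
      D.conjTranspose * Q * D := by fun_prop
  have hlim2 := (hcont.tendsto _).comp hlim
  have hclosed : IsClosed (compressedSpan v n d : Set (Operator n)) :=
    Submodule.closed_of_finiteDimensional _
  have h2 := hclosed.mem_of_tendsto hlim2 (Eventually.of_forall fun m => ?_)
  · rw [Matrix.conjTranspose_mul] at h2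
    change U.conjTranspose * ((encoding v n).conjTranspose * Q * encoding v n) * U ∈ _
    simpa only [Matrix.mul_assoc, SetLike.mem_coe] using h2
  · have h3 : (star (z m) • (C m * encoding v n)).conjTranspose * Q *
        (star (z m) • (C m * encoding v n)) =
        (encoding v n).conjTranspose * ((C m).conjTranspose * Q * C m) * encoding v n := by
      rw [Matrix.conjTranspose_smul, star_star, Matrix.smul_mul, Matrix.smul_mul, Matrix.mul_smul,
        smul_smul, mul_comm (z m), hzz, one_smul, Matrix.conjTranspose_mul]
      simp only [Matrix.mul_assoc]
    rw [Function.comp_apply, h3]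
    exact mem_compressedSpan ((hC m).conj_mem_majoranaSpan_pow hS d hQ)

/-- vZv* on the first block compresses to the logical Z, so invariance forces dimension at least
2^{n+1} − 1, against a bound that is polynomial in n for fixed k. -/
theorem not_isUniversalUnder_of_isMatchgate {S : Set TwoQubit} (hS : ∀ g ∈ S, IsMatchgate g)
    {v : Matrix (Fin k → Fin 2) (Fin 2) ℂ} (hv : v.conjTranspose * v = 1) :
    ¬ IsUniversalUnder S v := by
  intro hu
  obtain ⟨n, hn⟩ := exists_pow_lt_two_pow k
  have hZ : onQubit (0 : Fin (n + 1)) pauliZ ∈ compressedSpan v (n + 1) (2 * k) := by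
    have h := mem_compressedSpan (v := v)
      (onBlock_zero_mem_majoranaSpan_pow (n := n) (v * pauliZ * v.conjTranspose))
    rw [encoding_conjTranspose_mul_onBlock_mul hv] at h
    have h2 : v.conjTranspose * (v * pauliZ * v.conjTranspose) * v = pauliZ := by
      calc v.conjTranspose * (v * pauliZ * v.conjTranspose) * v =
          (v.conjTranspose * v) * pauliZ * (v.conjTranspose * v) := by
            simp only [Matrix.mul_assoc]
        _ = pauliZ := by rw [hv, Matrix.one_mul, Matrix.mul_one]
    rwa [h2] at h
  have hdiag : onQubit (0 : Fin (n + 1)) pauliZ =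
      Matrix.diagonal fun x => ![1, -1] (x 0) := by
    ext x y
    rw [onQubit, Matrix.of_apply, pauliZ_eq_diagonal]
    by_cases hxy : x = y
    · subst hxy; simp
    · rw [Matrix.diagonal_apply_ne _ hxy]
      split_ifs with h
      · refine Matrix.diagonal_apply_ne _ fun h0 => hxy (funext fun l => ?_)
        by_cases hl : l = 0
        · rw [hl, h0]
        · exact h l hl
      · rfl
  rw [hdiag] at hZ
  have hcard := card_le_finrank_add_one
    (fun U hU M hM => conj_mem_compressedSpan hS hu (2 * k) hU hM) hZ
    (x := fun _ => 0) (y := fun _ => 1) (by norm_num)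
  have hrank : Module.finrank ℂ (compressedSpan v (n + 1) (2 * k)) ≤
      ((n + 1) * k * 2 + 1) ^ (2 * k) :=
    (Submodule.finrank_map_le _ _).trans (finrank_majoranaSpan_pow_le _)
  have h := hcard.trans (Nat.add_le_add_right hrank 1)
  rw [Fintype.card_fun, Fintype.card_fin, Fintype.card_fin] at h
  omega

theorem matchgatesWith_subset {g : TwoQubit} (hg : IsMatchgate g) :
    ∀ h ∈ matchgatesWith g, IsMatchgate h := by
  rintro h (hh | rfl)
  exacts [hh, hg]

end

end Matchgate

/-! ### The main theorem -/

theorem mainTheorem4 (τ : ℝ) (hτ : τ ∈ Set.Icc 0 (Real.pi / 2)) :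
    -- the circuit is the diagonal gate diag(1, e^{iτ}, e^{iτ}, -1)
    encodingCircuit (swapFamily τ) = Matrix.diagonal (fun x : Fin 2 × Fin 2 =>
        !![1, Complex.exp (Complex.I * τ); Complex.exp (Complex.I * τ), -1] x.1 x.2) ∧
    -- on the middle pair of the four physical qubits it acts as this gate on the logical qubits
    onPair (1 : Fin (2 * 2)) (2 : Fin (2 * 2)) (encodingCircuit (swapFamily τ)) *
        encoding pairEncoding 2 =
      encoding pairEncoding 2 * onPair 0 1 (encodingCircuit (swapFamily τ)) ∧
    HasNonlocalParameters (encodingCircuit (swapFamily τ)) 0 0 (Real.pi / 4 - τ / 2) ∧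
    entanglingPower (encodingCircuit (swapFamily τ)) = Real.cos τ ^ 2 ∧
    -- universality, with any encoding and with the given one
    (IsUniversal (matchgatesWith (swapFamily τ)) ↔ τ ≠ Real.pi / 2) ∧
    (IsUniversalUnder (matchgatesWith (swapFamily τ)) pairEncoding ↔ τ ≠ Real.pi / 2) ∧
    (τ ≠ Real.pi / 2 →
      HasPolynomialOverheadUnder (matchgatesWith (swapFamily τ)) pairEncoding) ∧
    (τ ≠ Real.pi / 2 ↔ ¬ IsMatchgate (swapFamily τ)) := by
  have hS : ∀ g, IsMatchgate g → g ∈ matchgatesWith (swapFamily τ) := fun g hg => Or.inl hg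
  have himpl : τ ≠ Real.pi / 2 → ∃ s t, ImplementsPair (matchgatesWith (swapFamily τ)) s controlledZ ∧
      ImplementsPair (matchgatesWith (swapFamily τ)) t swapGate := by
    intro h
    obtain ⟨s, hs⟩ := exists_implementsPair_controlledZ hS hτ.1 (lt_of_le_of_ne hτ.2 h) (Or.inr rfl)
    obtain ⟨t, ht⟩ := exists_implementsPair_swapGate hS hs
    exact ⟨s, t, hs, ht⟩
  have hpos : τ ≠ Real.pi / 2 → IsUniversalUnder (matchgatesWith (swapFamily τ)) pairEncoding := by
    intro h
    obtain ⟨s, t, hs, ht⟩ := himpl h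
    exact isUniversalUnder_pairEncoding hS hs ht
  have hneg : τ = Real.pi / 2 → ∀ {k : ℕ} {v : Matrix (Fin k → Fin 2) (Fin 2) ℂ},
      v.conjTranspose * v = 1 → ¬ IsUniversalUnder (matchgatesWith (swapFamily τ)) v := fun h =>
    not_isUniversalUnder_of_isMatchgate
      (matchgatesWith_subset ((isMatchgate_swapFamily_iff hτ).2 h))
  refine ⟨encodingCircuit_swapFamily τ, ?_, hasNonlocalParameters_encodingCircuit τ,
    entanglingPower_encodingCircuit τ, ⟨?_, fun h => ⟨2, pairEncoding, pairEncoding_isometry, hpos h⟩⟩,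
    ⟨fun h h' => hneg h' pairEncoding_isometry h, hpos⟩, ?_,
    not_congr (isMatchgate_swapFamily_iff hτ).symm⟩
  · rw [encodingCircuit_swapFamily]
    -- The physical qubits 1 and 2 are, by evaluation, `blockQubit 0 1` and `blockQubit 1 0`.
    exact onPair_diagonal_mul_encoding (n := 2) 0 1 (encodedPhases τ)
  · rintro ⟨k, v, hv, hu⟩ h
    exact hneg h hv hu
  · intro h
    obtain ⟨s, t, hs, ht⟩ := himpl h
    exact hasPolynomialOverheadUnder_pairEncoding hS hs ht
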